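/- Let $R\subset\mathbb{R}^2$ be a convex polygon and let $T=(t_w)_{w\in W}$ be a finite tiling of $R$ by convex polygons with disjoint interiors (not necessarily edge-to-edge). Assume that $T$ is \emph{nondegenerate}: exactly one tile meets each corner of $R$, and every corner of a tile that is not a corner of $R$ lies in the relative interior of a side of a tile or of a side of $R$ (a ``T'', possibly with several legs). Let $\mathcal{G}$ be the bipartite planar graph whose white vertices are the tiles, whose black vertices are the maximal line segments in the union of the tile boundaries, and in which $w$ and $b$ are adjacent when the tile $t_w$ has a side along the segment $b$. The bounded faces of $\mathcal{G}$ correspond to the points that are corners of tiles but not corners of $R$; assume that all bounded faces of $\mathcal{G}$ are quadrilaterals, that is, exactly one segment ends at each such point. A \emph{homology tiling of $R$ combinatorially equivalent to $T$} is obtained by replacing the line through each black segment $b$ by an arbitrary line parallel to it (that is, by giving $b$ an arbitrary real intercept), the lines of the segments along the boundary of $R$ being kept fixed, and by replacing each tile $t_w$ by the closed polygonal path whose sides lie, in the same cyclic order, on the new lines of the segments adjacent to $w$; thus each corner of $t_w$ is replaced by the intersection point of the two corresponding new lines. The area of such a path is the integral of $x\,dy$ along it. For a convex polygon $t$ let $V_t$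 be the space of closed polygonal paths whose successive sides are real multiples of the sides of $t$ (taken in counterclockwise order); a path in $V_t$ of positive area has \emph{the same orientation as $t$} if it lies in the same connected component as $t$ of the set of paths of positive area in $V_t$. Theorem. Let $(A_w)_{w\in W}$ be positive reals with $\sum_{w} A_w=\mathrm{area}(R)$. Then there is a unique homology tiling of $R$ combinatorially equivalent to $T$ in which, for every $w\in W$, the tile $w$ has area $A_w$ and the same orientation as the original tile $t_w$. -/

import Mathlib

/-- The area form on closed polygonal paths in the plane `ℂ`: the integral of `x dy` along the
closed path with vertices `v 0, v 1, …, v (n - 1), v 0`, where the side from `v j` to the cyclically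
next vertex is parametrized affinely on `[0, 1]`. -/
noncomputable def pathArea {n : ℕ} (v : Fin n → ℂ) : ℝ :=
  ∑ j : Fin n, ∫ t in (0 : ℝ)..1,
    (AffineMap.lineMap (v j) (v (finRotate n j)) t : ℂ).re * (v (finRotate n j) - v j).im

/-- The integral of `x dy` along the sides, evaluated. -/
theorem pathArea_eq {n : ℕ} (v : Fin n → ℂ) :
    pathArea v = ∑ j : Fin n,
      ((v j).re + (v (finRotate n j)).re) / 2 * ((v (finRotate n j)).im - (v j).im) := by
  unfold pathArea
  refine Finset.sum_congr rfl fun j _ => ?_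
  rw [intervalIntegral.integral_mul_const]
  have h : ∀ t : ℝ, (AffineMap.lineMap (v j) (v (finRotate n j)) t : ℂ).re
      = (v j).re + t * ((v (finRotate n j)).re - (v j).re) := by
    intro t
    simp [AffineMap.lineMap_apply]
    ring
  simp only [h, Complex.sub_im]
  rw [intervalIntegral.integral_add intervalIntegrable_const
    (intervalIntegral.intervalIntegrable_id.mul_const _), intervalIntegral.integral_mul_const]
  simp only [intervalIntegral.integral_const, integral_id, smul_eq_mul]
  ring

/-- A convex polygon in the plane `ℂ`, given by its corners in counterclockwise order:
for every side, all the corners other than its two endpoints lie strictly to its left. -/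
structure ConvexPolygon where
  /-- the number of sides -/
  n : ℕ
  three_le : 3 ≤ n
  /-- the corners, in counterclockwise order -/
  vertex : Fin n → ℂ
  strictly_left : ∀ j k : Fin n, k ≠ j → k ≠ finRotate n j →
    0 < ((starRingEnd ℂ) (vertex (finRotate n j) - vertex j) * (vertex k - vertex j)).im

namespace ConvexPolygon

/-- The closed region bounded by the polygon. -/
def region (P : ConvexPolygon) : Set ℂ := convexHull ℝ (Set.range P.vertex)

/-- The set of corners of the polygon. -/
def corners (P : ConvexPolygon) : Set ℂ := Set.range P.vertex

/-- The `j`-th (closed) side of the polygon. -/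
def side (P : ConvexPolygon) (j : Fin P.n) : Set ℂ :=
  segment ℝ (P.vertex j) (P.vertex (finRotate P.n j))

/-- The relative interior of the `j`-th side of the polygon. -/
def openSide (P : ConvexPolygon) (j : Fin P.n) : Set ℂ :=
  openSegment ℝ (P.vertex j) (P.vertex (finRotate P.n j))

/-- The area of the polygon. -/
noncomputable def area (P : ConvexPolygon) : ℝ := pathArea P.vertex

/-- The homology tiles of shape `t`: closed polygonal paths whose successive sides are real
multiples (positive, negative or zero) of the sides of `t`. -/
def homologyTiles (t : ConvexPolygon) : Set (Fin t.n → ℂ) :=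
  {u | ∀ j, ∃ a : ℝ,
    u (finRotate t.n j) - u j = a • (t.vertex (finRotate t.n j) - t.vertex j)}

/-- A homology tile of shape `t` has positive area and the same orientation as `t` if it lies in
the same connected component of the space of homology tiles of positive area as `t` itself. -/
def SameOrientation (t : ConvexPolygon) (u : Fin t.n → ℂ) : Prop :=
  u ∈ connectedComponentIn {u | u ∈ t.homologyTiles ∧ 0 < pathArea u} t.vertex

end ConvexPolygon

/-- A tiling of the convex polygon `R` by convex polygons indexed by `W`: the tiles cover `R` and
have disjoint interiors. Tiles need not meet edge-to-edge. -/
structure ConvexTiling (R : ConvexPolygon) (W : Type*) where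
  /-- the tiles -/
  tile : W → ConvexPolygon
  cover : ⋃ w, (tile w).region = R.region
  disjoint_interior : ∀ w w', w ≠ w' →
    Disjoint (interior (tile w).region) (interior (tile w').region)

namespace ConvexTiling

variable {R : ConvexPolygon} {W : Type*}

/-- `S` is a maximal line segment in the union of the tile boundaries. -/
def IsMaximalSegment (T : ConvexTiling R W) (S : Set ℂ) : Prop :=
  Maximal (fun S : Set ℂ => (∃ x y : ℂ, x ≠ y ∧ S = segment ℝ x y) ∧
    S ⊆ ⋃ w, frontier (T.tile w).region) S

/-- The black vertices of the bipartite graph of the tiling: the maximal line segments in the tile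
boundaries. (The white vertices are the tiles, that is, the elements of `W`.) -/
def Black (T : ConvexTiling R W) : Type := {S : Set ℂ // T.IsMaximalSegment S}

/-- A boundary black vertex: a maximal segment along the boundary of `R`. -/
def IsBoundary (T : ConvexTiling R W) (b : T.Black) : Prop := b.1 ⊆ frontier R.region

/-- Adjacency in the bipartite graph: the tile `w` has a side along the maximal segment `b`. -/
def Adj (T : ConvexTiling R W) (w : W) (b : T.Black) : Prop := ∃ j, (T.tile w).side j ⊆ b.1

/-- The tiling is nondegenerate: exactly one tile meets each corner of `R`, and each other corner
of a tile is at a `T` (possibly with several legs), that is, in the relative interior of a side of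
a tile or of a side of `R`. -/
def Nondegenerate (T : ConvexTiling R W) : Prop :=
  (∀ p ∈ R.corners, ∃! w, p ∈ (T.tile w).region) ∧
  ∀ w, ∀ p ∈ (T.tile w).corners, p ∉ R.corners →
    (∃ w' j, p ∈ (T.tile w').openSide j) ∨ ∃ k, p ∈ R.openSide k

/-- The bounded faces of the bipartite graph correspond to the `T`s of the (nondegenerate) tiling:
the points that are corners of tiles but not corners of `R`. -/
def faces (T : ConvexTiling R W) : Set ℂ := (⋃ w, (T.tile w).corners) \ R.corners

/-- The degree of the bounded face of the bipartite graph at the `T` located at `p`: the number of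
edges `wb` of the graph around `p`, that is, such that the tile `w` has a corner at `p` and one of
its two sides ending at `p` lies along the segment `b`. -/
noncomputable def faceDegree (T : ConvexTiling R W) (p : ℂ) : ℕ :=
  {e : W × T.Black | p ∈ (T.tile e.1).corners ∧ p ∈ e.2.1 ∧ T.Adj e.1 e.2}.ncard

/-- All bounded faces of the bipartite graph are quadrilaterals. -/
def QuadFaces (T : ConvexTiling R W) : Prop := ∀ p ∈ T.faces, T.faceDegree p = 4

/-- A homology tiling of `R` combinatorially equivalent to `T`: each maximal segment `b` of `T` is
assigned a line parallel to it (equivalently, an arbitrary real intercept), boundary segments keeping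
their lines, and each tile `w` becomes the closed polygonal path whose sides lie, in the same cyclic
order, on the lines of the segments adjacent to `w`. Corner `j` of tile `w` is thus the
intersection of the lines assigned to the segments carrying the two sides of `w` at that corner. -/
structure HomologyTiling (T : ConvexTiling R W) where
  /-- the line assigned to each maximal segment -/
  line : T.Black → AffineSubspace ℝ ℂ
  line_parallel : ∀ b, (line b).Parallel (affineSpan ℝ b.1)
  line_boundary : ∀ b, T.IsBoundary b → line b = affineSpan ℝ b.1
  /-- the corners of each homology tile -/
  path : ∀ w, Fin (T.tile w).n → ℂ
  path_mem : ∀ w j b, (T.tile w).side j ⊆ b.1 →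
    path w j ∈ line b ∧ path w (finRotate (T.tile w).n j) ∈ line b

end ConvexTiling

/-! Homology tilings form a real vector space `T.Offset`, one intercept for each interior segment,
and the corners of every tile depend affinely on it: tile `w` becomes `t_w + disp w x`. Areas are
thus quadratic polynomials in `x`, and three facts control them.

Signature. On paths of a fixed shape, written in heights over a generic direction, the area is a
diagonal form with one coefficient per corner (`pathArea_eq_sum_slopeAt`). Convexity makes every
coefficient negative except those of the lowest and the highest corner. Translating the lowest
corner to height zero leaves at most one positive direction, so a path orthogonal to a path of
positive area has nonpositive area, with equality only for a constant path
(`pathArea_of_areaForm_eq_zero`). Likewise "same orientation as `t`" becomes positivity of the polar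
form against `t` (`sameOrientation_iff`).

Conservation. At a quadrilateral face one segment passes through and another ends, so the two tile
corners there lie on the same two lines, move together, and have opposite coefficients. The total
area is therefore constant in `x` (`sum_pathArea`), and the quadratic parts `pathArea (disp w v)`
sum to zero. Hence if all of them are nonpositive they all vanish, each tile is merely translated,
and rigidity (`eq_zero_of_disp_const`) gives `v = 0`.

Counting. Sending a tile to the segment that ends at its lowest corner is injective, apart from the
one tile at the lowest corner of `R` (`card_le`). As the derivative of the areas is injective
wherever all areas are positive, its image is the whole hyperplane of vectors with sum zero.

Uniqueness: if `u` and `v` have equal positive area and the same orientation, then `u - v` is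
orthogonal to `u + v`, which has positive area; apply the above to the difference of the two
offsets. Existence: maximize `∏ area_w ^ A_w` over the tilings with nonnegative areas and the right
orientation, a compact set. At a maximum all areas are positive, and the criticality condition
forces the ratios `A_w / area_w` to be equal, hence equal to one because both families have the same
sum. -/

/-! ### Linear algebra of the plane -/

/-- The wedge product of two vectors of the plane `ℂ`. -/
def wedge (z w : ℂ) : ℝ := z.re * w.im - z.im * w.re

theorem wedge_add_right (z w w' : ℂ) : wedge z (w + w') = wedge z w + wedge z w' := by
  simp [wedge]; ring

theorem wedge_sub_right (z w w' : ℂ) : wedge z (w - w') = wedge z w - wedge z w' := by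
  simp [wedge]; ring

theorem wedge_add_left (z z' w : ℂ) : wedge (z + z') w = wedge z w + wedge z' w := by
  simp [wedge]; ring

theorem wedge_smul_right (z : ℂ) (r : ℝ) (w : ℂ) : wedge z (r • w) = r * wedge z w := by
  simp [wedge]; ring

theorem wedge_smul_left (r : ℝ) (z w : ℂ) : wedge (r • z) w = r * wedge z w := by
  simp [wedge]; ring

theorem wedge_neg_right (z w : ℂ) : wedge z (-w) = -wedge z w := by
  simp [wedge]; ring

theorem wedge_neg_left (z w : ℂ) : wedge (-z) w = -wedge z w := by
  simp [wedge]; ring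

@[simp] theorem wedge_self (z : ℂ) : wedge z z = 0 := by
  simp [wedge]; ring

@[simp] theorem wedge_zero_right (z : ℂ) : wedge z 0 = 0 := by simp [wedge]

theorem wedge_swap (z w : ℂ) : wedge w z = -wedge z w := by
  simp [wedge]; ring

theorem wedge_I_mul (z : ℂ) : wedge z (Complex.I * z) = z.re ^ 2 + z.im ^ 2 := by
  simp [wedge]; ring

theorem wedge_I_mul_pos {z : ℂ} (hz : z ≠ 0) : 0 < wedge z (Complex.I * z) := by
  rw [wedge_I_mul]
  have : z.re ≠ 0 ∨ z.im ≠ 0 := by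
    by_contra! h
    exact hz (Complex.ext h.1 h.2)
  rcases this with h | h <;> positivity

/-- Cramer's rule with the denominator cleared. It expresses membership in the cone at a corner by
the signs of two wedges. -/
theorem wedge_decomp (p a d : ℂ) : wedge p a • d = wedge p d • a - wedge a d • p := by
  apply Complex.ext <;> simp [wedge] <;> ring

theorem ne_zero_of_wedge_right {z w : ℂ} (h : wedge z w ≠ 0) : w ≠ 0 := by
  rintro rfl; simp at h

theorem exists_smul_of_wedge_eq_zero {z w : ℂ} (hz : z ≠ 0) (h : wedge z w = 0) :
    ∃ r : ℝ, w = r • z := by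
  have h1 := wedge_decomp z (Complex.I * z) w
  rw [h, zero_smul, zero_sub] at h1
  have h2 := wedge_I_mul_pos hz
  refine ⟨-wedge (Complex.I * z) w / wedge z (Complex.I * z), ?_⟩
  rw [div_eq_inv_mul, mul_smul, neg_smul, ← h1, smul_smul, inv_mul_cancel₀ h2.ne', one_smul]

theorem continuous_wedge_right (z : ℂ) : Continuous (wedge z) := by
  unfold wedge; fun_prop

theorem eq_of_wedge_eq {p a d d' : ℂ} (hpa : wedge p a ≠ 0) (h1 : wedge p d = wedge p d')
    (h2 : wedge a d = wedge a d') : d = d' := by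
  have e1 := wedge_decomp p a d
  have e2 := wedge_decomp p a d'
  rw [h1, h2, ← e2] at e1
  exact smul_right_injective ℂ hpa e1

theorem finRotate_val {n : ℕ} (j : Fin n) :
    (finRotate n j : ℕ) = if (j : ℕ) + 1 = n then 0 else (j : ℕ) + 1 := by
  cases n with
  | zero => exact j.elim0
  | succ n =>
    rw [coe_finRotate]
    simp [Fin.ext_iff]

/-! ### Convex polygons as intersections of half-planes -/

namespace ConvexPolygon

variable (P : ConvexPolygon)

/-- The index cyclically preceding `j`. -/
def prev (j : Fin P.n) : Fin P.n := (finRotate P.n).symm j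

@[simp] theorem next_prev (j : Fin P.n) : finRotate P.n (P.prev j) = j :=
  (finRotate P.n).apply_symm_apply j

@[simp] theorem prev_next (j : Fin P.n) : P.prev (finRotate P.n j) = j :=
  (finRotate P.n).symm_apply_apply j

theorem next_ne (j : Fin P.n) : finRotate P.n j ≠ j := by
  have h := P.three_le
  have h1 := finRotate_val j
  have h2 := j.2
  rw [Ne, Fin.ext_iff, h1]
  split_ifs <;> omega

theorem next_next_ne (j : Fin P.n) : finRotate P.n (finRotate P.n j) ≠ j := by
  have h := P.three_le
  have h1 := finRotate_val j
  have h2 := j.2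
  rw [Ne, Fin.ext_iff, finRotate_val, h1]
  split_ifs <;> omega

theorem prev_ne (j : Fin P.n) : P.prev j ≠ j := fun h => by
  have := P.next_ne (P.prev j)
  rw [next_prev, h] at this
  exact this rfl

theorem next_ne_prev (j : Fin P.n) : finRotate P.n j ≠ P.prev j := fun h => by
  apply P.next_next_ne (P.prev j)
  rw [next_prev, h]

/-- A function on the cyclically ordered indices that is invariant under the cyclic shift is
constant. -/
theorem eq_of_next_eq {α : Type*} {u : Fin P.n → α} (h : ∀ j, u (finRotate P.n j) = u j)
    (j k : Fin P.n) : u j = u k := by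
  have h3 := P.three_le
  have key : ∀ (m : ℕ) (hm : m < P.n), u ⟨m, hm⟩ = u ⟨0, by omega⟩ := by
    intro m
    induction m with
    | zero => intro _; rfl
    | succ m ih =>
      intro hm
      rw [← ih (by omega), ← h ⟨m, by omega⟩]
      congr 1
      rw [Fin.ext_iff, finRotate_val, if_neg (by simp; omega)]
  exact (key j j.2).trans (key k k.2).symm

/-- The `j`-th edge vector. -/
def edge (j : Fin P.n) : ℂ := P.vertex (finRotate P.n j) - P.vertex j

theorem edge_prev (j : Fin P.n) : P.edge (P.prev j) = P.vertex j - P.vertex (P.prev j) := by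
  rw [edge, next_prev]

/-- The affine function that defines the half-plane to the left of the `j`-th side. -/
def height (j : Fin P.n) (z : ℂ) : ℝ := wedge (P.edge j) (z - P.vertex j)

theorem height_vertex_pos {j k : Fin P.n} (h : k ≠ j) (h' : k ≠ finRotate P.n j) :
    0 < P.height j (P.vertex k) := by
  have := P.strictly_left j k h h'
  rw [Complex.mul_im] at this
  simp only [Complex.conj_re, Complex.conj_im] at this
  unfold height wedge edge
  linarith

@[simp] theorem height_self (j : Fin P.n) : P.height j (P.vertex j) = 0 := by
  simp [height]

@[simp] theorem height_next (j : Fin P.n) : P.height j (P.vertex (finRotate P.n j)) = 0 :=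
  wedge_self _

theorem height_prev (j : Fin P.n) : P.height (P.prev j) (P.vertex j) = 0 := by
  have := P.height_next (P.prev j)
  rwa [next_prev] at this

theorem height_vertex_nonneg (j k : Fin P.n) : 0 ≤ P.height j (P.vertex k) := by
  by_cases h : k = j
  · subst h; simp
  · by_cases h' : k = finRotate P.n j
    · subst h'; exact (P.height_next j).ge
    · exact (P.height_vertex_pos h h').le

theorem height_vertex_eq_zero {j k : Fin P.n} :
    P.height j (P.vertex k) = 0 ↔ j = k ∨ j = P.prev k := by
  constructor
  · intro h
    by_contra! hc
    refine (P.height_vertex_pos (j := j) (k := k) (Ne.symm hc.1) ?_).ne' h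
    rintro rfl
    exact hc.2 (P.prev_next j).symm
  · rintro (rfl | rfl)
    · simp
    · exact P.height_prev k

theorem wedge_edge_pos (j : Fin P.n) : 0 < wedge (P.edge (P.prev j)) (P.edge j) := by
  have h := P.height_vertex_pos (P.next_ne_prev j) (by rw [next_prev]; exact P.next_ne j)
  rw [height] at h
  have e : P.vertex (finRotate P.n j) - P.vertex (P.prev j)
      = P.edge j + P.edge (P.prev j) := by
    rw [edge_prev, edge]; ring
  rwa [e, wedge_add_right, wedge_self, add_zero] at h

theorem edge_ne_zero (j : Fin P.n) : P.edge j ≠ 0 :=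
  ne_zero_of_wedge_right (P.wedge_edge_pos j).ne'

theorem vertex_injective : Function.Injective P.vertex := by
  intro j k h
  have h1 : P.height j (P.vertex k) = 0 := by rw [← h]; simp
  have h2 : P.height k (P.vertex j) = 0 := by rw [h]; simp
  rw [height_vertex_eq_zero] at h1 h2
  rcases h1 with h1 | h1
  · exact h1
  · rcases h2 with h2 | h2
    · exact h2.symm
    -- Here `j` and `k` would precede each other, a cycle of length two.
    · exfalso
      apply P.next_ne_prev j
      rw [← h2]
      nth_rw 1 [h1]
      rw [next_prev]

theorem height_add_smul (j : Fin P.n) (z d : ℂ) (s : ℝ) :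
    P.height j (z + s • d) = P.height j z + s * wedge (P.edge j) d := by
  unfold height
  rw [add_sub_right_comm, wedge_add_right, wedge_smul_right]

theorem continuous_height (j : Fin P.n) : Continuous (P.height j) :=
  (continuous_wedge_right _).comp (by fun_prop)

theorem convex_halfplanes : Convex ℝ {z | ∀ j, 0 ≤ P.height j z} := by
  rw [Set.ofPred_forall]
  refine convex_iInter fun j => ?_
  intro x hx y hy a b ha hb hab
  have e : P.height j (a • x + b • y) = a * P.height j x + b * P.height j y := by
    have : b = 1 - a := by linarith
    subst this
    simp [height, wedge]; ring
  simp only [Set.mem_ofPred_eq] at *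
  rw [e]; positivity

/-- For the converse, separate `z` from the polygon by a functional and take a corner maximizing it.
The functional does not increase along the two sides leading away from that corner, and `z` lies in
the cone that they span, so it cannot exceed the maximum. -/
theorem mem_region_iff {z : ℂ} : z ∈ P.region ↔ ∀ j, 0 ≤ P.height j z := by
  constructor
  · intro hz
    have : P.region ⊆ {z | ∀ j, 0 ≤ P.height j z} :=
      convexHull_min (by rintro _ ⟨k, rfl⟩ j; exact P.height_vertex_nonneg j k)
        P.convex_halfplanes
    exact this hz
  · intro hz
    by_contra hn
    have hcl : IsClosed P.region :=
      ((Set.finite_range P.vertex).isCompact_convexHull (𝕜 := ℝ)).isClosed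
    obtain ⟨f, c, hf, hc⟩ := geometric_hahn_banach_closed_point (convex_convexHull ℝ _) hcl hn
    have : Nonempty (Fin P.n) := ⟨⟨0, by have := P.three_le; omega⟩⟩
    obtain ⟨k, hk⟩ := Finite.exists_max fun j => f (P.vertex j)
    have hfk := hf _ (subset_convexHull ℝ _ ⟨k, rfl⟩)
    have h1 := congrArg f (wedge_decomp (P.edge (P.prev k)) (P.edge k) (z - P.vertex k))
    simp only [map_smul, map_sub, smul_eq_mul] at h1
    have h2 : wedge (P.edge (P.prev k)) (z - P.vertex k) = P.height (P.prev k) z := by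
      have e : z - P.vertex k = (z - P.vertex (P.prev k)) - P.edge (P.prev k) := by
        rw [edge_prev]; ring
      rw [e, wedge_sub_right, wedge_self, sub_zero]; rfl
    have h3 : f (P.edge k) ≤ 0 := by
      rw [edge, map_sub]; linarith [hk (finRotate P.n k)]
    have h4 : 0 ≤ f (P.edge (P.prev k)) := by
      rw [edge_prev, map_sub]; linarith [hk (P.prev k)]
    have h5 := hz (P.prev k)
    have h6 : 0 ≤ wedge (P.edge k) (z - P.vertex k) := hz k
    rw [h2] at h1
    nlinarith [P.wedge_edge_pos k, mul_nonneg h6 h4, mul_nonneg h5 (neg_nonneg.2 h3)]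

theorem isCompact_region : IsCompact P.region :=
  (Set.finite_range P.vertex).isCompact_convexHull (𝕜 := ℝ)

theorem isClosed_region : IsClosed P.region := P.isCompact_region.isClosed

theorem vertex_mem_region (j : Fin P.n) : P.vertex j ∈ P.region :=
  subset_convexHull ℝ _ ⟨j, rfl⟩

theorem mem_interior_iff {z : ℂ} : z ∈ interior P.region ↔ ∀ j, 0 < P.height j z := by
  constructor
  · intro hz j
    refine lt_of_le_of_ne (P.mem_region_iff.1 (interior_subset hz) j) fun h0 => ?_
    -- Negative multiples of the inner normal leave the half-plane immediately.
    have hc : Filter.Tendsto (fun s : ℝ => z + s • (Complex.I * P.edge j)) (nhds 0) (nhds z) := by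
      have : Continuous fun s : ℝ => z + s • (Complex.I * P.edge j) := by fun_prop
      simpa using this.tendsto 0
    have h1 := hc.eventually (mem_interior_iff_mem_nhds.1 hz)
    obtain ⟨s, hs, hs0⟩ := ((h1.filter_mono (nhdsWithin_le_nhds (s := Set.Iio 0))).and
      self_mem_nhdsWithin).exists
    have h2 := P.mem_region_iff.1 hs j
    rw [height_add_smul, ← h0, zero_add] at h2
    have h3 := wedge_I_mul_pos (P.edge_ne_zero j)
    have h4 : s < 0 := hs0
    nlinarith
  · intro hz
    have ho : IsOpen {z | ∀ j, 0 < P.height j z} := by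
      rw [Set.ofPred_forall]
      exact isOpen_iInter_of_finite fun j => isOpen_lt continuous_const (P.continuous_height j)
    exact interior_maximal (fun z hz => P.mem_region_iff.2 fun j => (hz j).le) ho hz

/-- On the line through a side, the half-plane of the preceding side bounds the parameter below by 0
and that of the following side bounds it above by 1. -/
theorem mem_side_iff {j : Fin P.n} {z : ℂ} :
    z ∈ P.side j ↔ z ∈ P.region ∧ P.height j z = 0 := by
  constructor
  · intro hz
    refine ⟨(convex_convexHull ℝ _).segment_subset (P.vertex_mem_region _)
      (P.vertex_mem_region _) hz, ?_⟩
    rw [side, segment_eq_image'] at hz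
    obtain ⟨s, -, rfl⟩ := hz
    rw [height_add_smul, height_self]
    change 0 + s * wedge (P.edge j) (P.edge j) = 0
    rw [wedge_self, mul_zero, add_zero]
  · rintro ⟨hz, h0⟩
    obtain ⟨s, hs⟩ := exists_smul_of_wedge_eq_zero (P.edge_ne_zero j) h0
    have hz' : z = P.vertex j + s • P.edge j := by rw [← hs]; ring
    have h1 := P.mem_region_iff.1 hz (P.prev j)
    have h2 := P.mem_region_iff.1 hz (finRotate P.n j)
    have h3 : z = P.vertex (finRotate P.n j) + (s - 1) • P.edge j := by
      rw [hz', sub_smul, one_smul, edge]; ring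
    rw [hz', height_add_smul, height_prev] at h1
    rw [h3, height_add_smul, height_self] at h2
    have h4 := P.wedge_edge_pos j
    have h5 := P.wedge_edge_pos (finRotate P.n j)
    rw [prev_next] at h5
    rw [wedge_swap] at h2
    rw [side, segment_eq_image']
    exact ⟨s, ⟨by nlinarith, by nlinarith⟩, hz'.symm⟩

theorem frontier_region : frontier P.region = ⋃ j, P.side j := by
  ext z
  rw [P.isClosed_region.frontier_eq, Set.mem_sdiff, mem_interior_iff, Set.mem_iUnion]
  simp only [mem_side_iff]
  constructor
  · rintro ⟨h, h'⟩
    push Not at h'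
    obtain ⟨j, hj⟩ := h'
    exact ⟨j, h, le_antisymm hj (P.mem_region_iff.1 h j)⟩
  · rintro ⟨j, h, h'⟩
    exact ⟨h, fun hc => (hc j).ne' h'⟩

theorem height_eq_zero_of_mem_openSide {j k : Fin P.n} {z : ℂ} (hz : z ∈ P.openSide j) :
    P.height k z = 0 ↔ k = j := by
  have hs : z ∈ P.side j := openSegment_subset_segment ℝ _ _ hz
  refine ⟨fun h => ?_, fun h => h ▸ (P.mem_side_iff.1 hs).2⟩
  obtain ⟨a, b, ha, hb, hab, rfl⟩ := hz
  have e : P.height k (a • P.vertex j + b • P.vertex (finRotate P.n j))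
      = a * P.height k (P.vertex j) + b * P.height k (P.vertex (finRotate P.n j)) := by
    have : b = 1 - a := by linarith
    subst this
    simp [height, wedge]; ring
  rw [e] at h
  have h1 := P.height_vertex_nonneg k j
  have h2 := P.height_vertex_nonneg k (finRotate P.n j)
  have h3 : P.height k (P.vertex j) = 0 := by nlinarith [mul_nonneg hb.le h2]
  have h4 : P.height k (P.vertex (finRotate P.n j)) = 0 := by nlinarith [mul_nonneg ha.le h1]
  rw [height_vertex_eq_zero] at h3 h4
  rw [prev_next] at h4
  rcases h3 with h3 | h3
  · exact h3
  · rcases h4 with h4 | h4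
    · exact absurd (h4.symm.trans h3) (P.next_ne_prev j)
    · exact h4

theorem openSide_subset_region (j : Fin P.n) : P.openSide j ⊆ P.region := fun _ hz =>
  (P.mem_side_iff.1 (openSegment_subset_segment ℝ _ _ hz)).1

end ConvexPolygon

/-! ### The area as a quadratic form -/

/-- The polar form of `pathArea`. -/
noncomputable def areaForm (n : ℕ) : (Fin n → ℂ) →ₗ[ℝ] (Fin n → ℂ) →ₗ[ℝ] ℝ :=
  LinearMap.mk₂ ℝ
    (fun u v => ∑ j, (wedge (u j) (v (finRotate n j)) + wedge (v j) (u (finRotate n j))) / 4)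
    (fun u u' v => by
      rw [← Finset.sum_add_distrib]
      refine Finset.sum_congr rfl fun j _ => ?_
      simp only [Pi.add_apply, wedge_add_left, wedge_add_right]; ring)
    (fun c u v => by
      rw [smul_eq_mul, Finset.mul_sum]
      refine Finset.sum_congr rfl fun j _ => ?_
      simp only [Pi.smul_apply, wedge_smul_left, wedge_smul_right]; ring)
    (fun u v v' => by
      rw [← Finset.sum_add_distrib]
      refine Finset.sum_congr rfl fun j _ => ?_
      simp only [Pi.add_apply, wedge_add_left, wedge_add_right]; ring)
    (fun c u v => by
      rw [smul_eq_mul, Finset.mul_sum]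
      refine Finset.sum_congr rfl fun j _ => ?_
      simp only [Pi.smul_apply, wedge_smul_left, wedge_smul_right]; ring)

theorem areaForm_apply {n : ℕ} (u v : Fin n → ℂ) : areaForm n u v =
    ∑ j, (wedge (u j) (v (finRotate n j)) + wedge (v j) (u (finRotate n j))) / 4 := rfl

theorem areaForm_comm {n : ℕ} (u v : Fin n → ℂ) : areaForm n u v = areaForm n v u := by
  simp only [areaForm_apply]
  exact Finset.sum_congr rfl fun j _ => by ring

theorem pathArea_eq_sum_wedge {n : ℕ} (u : Fin n → ℂ) (z : ℂ) :
    pathArea u = ∑ j, wedge (u j - z) (u (finRotate n j) - z) / 2 := by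
  rw [pathArea_eq, ← sub_eq_zero, ← Finset.sum_sub_distrib]
  -- A cyclically telescoping term turns the trapezoid formula into the shoelace formula centered at
  -- `z`.
  have h2 := Equiv.sum_comp (finRotate n) fun j =>
    (u j).re * (u j).im / 2 + z.re * (u j).im / 2 - z.im * (u j).re / 2
  rw [← sub_eq_zero, ← Finset.sum_sub_distrib] at h2
  rw [← h2]
  refine Finset.sum_congr rfl fun j _ => ?_
  simp only [wedge, Complex.sub_re, Complex.sub_im]
  ring

theorem areaForm_self {n : ℕ} (u : Fin n → ℂ) : areaForm n u u = pathArea u := by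
  rw [pathArea_eq_sum_wedge u 0, areaForm_apply]
  exact Finset.sum_congr rfl fun j _ => by rw [sub_zero, sub_zero]; ring

theorem pathArea_sub_const {n : ℕ} (u : Fin n → ℂ) (z : ℂ) :
    pathArea (fun j => u j - z) = pathArea u := by
  rw [pathArea_eq_sum_wedge u z, pathArea_eq_sum_wedge _ 0]
  simp only [sub_zero]

theorem pathArea_add {n : ℕ} (u v : Fin n → ℂ) :
    pathArea (u + v) = pathArea u + 2 * areaForm n u v + pathArea v := by
  simp only [← areaForm_self, map_add, LinearMap.add_apply]
  rw [areaForm_comm v u]; ring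

theorem pathArea_smul {n : ℕ} (s : ℝ) (u : Fin n → ℂ) :
    pathArea (s • u) = s ^ 2 * pathArea u := by
  simp only [← areaForm_self, map_smul, LinearMap.smul_apply, smul_eq_mul]
  ring

theorem continuous_pathArea {n : ℕ} : Continuous (pathArea : (Fin n → ℂ) → ℝ) := by
  have : (pathArea : (Fin n → ℂ) → ℝ) = fun v => ∑ j : Fin n,
      ((v j).re + (v (finRotate n j)).re) / 2 * ((v (finRotate n j)).im - (v j).im) :=
    funext pathArea_eq
  rw [this]
  fun_prop

/-- The linear functional `z ↦ im z - t * re z`. -/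
noncomputable def tilt (t : ℝ) : ℂ →ₗ[ℝ] ℝ := Complex.imLm - t • Complex.reLm

theorem tilt_apply (t : ℝ) (z : ℂ) : tilt t z = z.im - t * z.re := rfl

/-- Each nonzero vector excludes at most one value of `t`. -/
theorem exists_tilt_ne_zero {ι : Type*} [Finite ι] (e : ι → ℂ) (he : ∀ i, e i ≠ 0) :
    ∃ t, ∀ i, tilt t (e i) ≠ 0 := by
  obtain ⟨t, ht⟩ := (Set.finite_range fun i => (e i).im / (e i).re).exists_notMem
  refine ⟨t, fun i h => ?_⟩
  rw [tilt_apply] at h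
  by_cases h0 : (e i).re = 0
  · rw [h0, mul_zero, sub_zero] at h
    exact he i (Complex.ext h0 h)
  · exact ht ⟨i, by rw [div_eq_iff h0]; linarith⟩

/-- The inverse slope of a vector with respect to the functional `tilt t`. -/
noncomputable def slopeAt (t : ℝ) (z : ℂ) : ℝ := z.re / tilt t z

theorem slopeAt_smul (t : ℝ) {r : ℝ} (hr : r ≠ 0) (z : ℂ) :
    slopeAt t (r • z) = slopeAt t z := by
  rw [slopeAt, slopeAt, map_smul, Complex.smul_re, smul_eq_mul, smul_eq_mul,
    mul_div_mul_left _ _ hr]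

/-- A left turn between two vectors that both rise or both fall lowers the inverse slope; this fixes
the signs of the diagonal coefficients of the area. -/
theorem slopeAt_sub (t : ℝ) {p e : ℂ} (hp : tilt t p ≠ 0) (he : tilt t e ≠ 0) :
    slopeAt t e - slopeAt t p = -wedge p e / (tilt t p * tilt t e) := by
  rw [slopeAt, slopeAt, div_sub_div _ _ he hp, mul_comm (tilt t e) (tilt t p)]
  congr 1
  simp only [tilt_apply, wedge]; ring

/-- The coordinates `(re, tilt t)` are a shear of the standard ones, so they preserve the wedge. -/
theorem wedge_eq_tilt (t : ℝ) (z w : ℂ) : wedge z w = z.re * tilt t w - tilt t z * w.re := by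
  simp only [tilt_apply, wedge]; ring

/-! ### Signature of the area form, and orientation -/

namespace ConvexPolygon

variable (P : ConvexPolygon)

theorem vertex_mem_homologyTiles : P.vertex ∈ P.homologyTiles := fun _ => ⟨1, (one_smul _ _).symm⟩

variable {P}

theorem add_mem_homologyTiles {u v : Fin P.n → ℂ} (hu : u ∈ P.homologyTiles)
    (hv : v ∈ P.homologyTiles) : u + v ∈ P.homologyTiles := fun j => by
  obtain ⟨a, ha⟩ := hu j
  obtain ⟨b, hb⟩ := hv j
  refine ⟨a + b, ?_⟩
  rw [add_smul, ← ha, ← hb, Pi.add_apply, Pi.add_apply]; ring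

theorem smul_mem_homologyTiles (r : ℝ) {u : Fin P.n → ℂ} (hu : u ∈ P.homologyTiles) :
    r • u ∈ P.homologyTiles := fun j => by
  obtain ⟨a, ha⟩ := hu j
  exact ⟨r * a, by rw [mul_smul, ← ha, Pi.smul_apply, Pi.smul_apply, smul_sub]⟩

theorem sub_mem_homologyTiles {u v : Fin P.n → ℂ} (hu : u ∈ P.homologyTiles)
    (hv : v ∈ P.homologyTiles) : u - v ∈ P.homologyTiles := by
  have := add_mem_homologyTiles hu (smul_mem_homologyTiles (-1) hv)
  rwa [neg_one_smul, ← sub_eq_add_neg] at this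

theorem sub_const_mem_homologyTiles {u : Fin P.n → ℂ} (hu : u ∈ P.homologyTiles) (z : ℂ) :
    (fun j => u j - z) ∈ P.homologyTiles := fun j => by
  obtain ⟨a, ha⟩ := hu j
  exact ⟨a, by rw [← ha]; ring⟩

/-- The area of a homology tile is diagonal in the heights of its corners with respect to a generic
direction. -/
theorem pathArea_eq_sum_slopeAt {t : ℝ} (ht : ∀ j, tilt t (P.edge j) ≠ 0) {u : Fin P.n → ℂ}
    (hu : u ∈ P.homologyTiles) : pathArea u =
      ∑ j, (slopeAt t (P.edge j) - slopeAt t (P.edge (P.prev j))) / 2 * tilt t (u j) ^ 2 := by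
  -- Along the line of a side, the real part is an affine function of the height.
  have hc : ∀ j, (u (finRotate P.n j)).re - (u j).re
      = slopeAt t (P.edge j) * (tilt t (u (finRotate P.n j)) - tilt t (u j)) := by
    intro j
    obtain ⟨a, ha⟩ := hu j
    rw [← map_sub, ← Complex.sub_re, ha]
    change (a • P.edge j).re = slopeAt t (P.edge j) * tilt t (a • P.edge j)
    rw [map_smul, slopeAt, Complex.smul_re, smul_eq_mul, smul_eq_mul]
    field_simp [ht j]
  -- Summation by parts around the path, which moves the inverse slopes from the sides to the
  -- corners.
  have hs := Equiv.sum_comp (finRotate P.n) fun j =>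
    ((u j).re - slopeAt t (P.edge (P.prev j)) * tilt t (u j)) / 2 * tilt t (u j)
  rw [← sub_eq_zero, ← Finset.sum_sub_distrib] at hs
  rw [pathArea_eq_sum_wedge u 0, ← sub_eq_zero, ← Finset.sum_sub_distrib, ← hs]
  refine Finset.sum_congr rfl fun j _ => ?_
  rw [sub_zero, sub_zero, wedge_eq_tilt t, prev_next]
  have := hc j
  have e : (u (finRotate P.n j)).re = (u j).re
      + slopeAt t (P.edge j) * (tilt t (u (finRotate P.n j)) - tilt t (u j)) := by linarith
  rw [e]
  ring

variable (P)

theorem wedge_edge_prev_sub (j : Fin P.n) (z : ℂ) :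
    wedge (P.edge (P.prev j)) (z - P.vertex j) = P.height (P.prev j) z := by
  have e : z - P.vertex j = (z - P.vertex (P.prev j)) - P.edge (P.prev j) := by
    rw [edge_prev]; ring
  rw [e, wedge_sub_right, wedge_self, sub_zero]; rfl

/-- A corner at which a linear functional turns from decreasing to increasing is its strict minimum
over the corners. -/
theorem lt_vertex_of_turn (f : ℂ →ₗ[ℝ] ℝ) {j k : Fin P.n} (h1 : f (P.edge (P.prev j)) < 0)
    (h2 : 0 < f (P.edge j)) (hk : k ≠ j) : f (P.vertex j) < f (P.vertex k) := by
  -- All corners lie in the cone at corner `j` spanned by the outgoing side and the reversed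
  -- incoming side, and `f` is positive on both generators.
  have h := congrArg f
    (wedge_decomp (P.edge (P.prev j)) (P.edge j) (P.vertex k - P.vertex j))
  rw [wedge_edge_prev_sub] at h
  change _ = f (P.height (P.prev j) (P.vertex k) • P.edge j
    - P.height j (P.vertex k) • P.edge (P.prev j)) at h
  simp only [map_smul, map_sub, smul_eq_mul] at h
  have a1 := P.height_vertex_nonneg (P.prev j) k
  have a2 := P.height_vertex_nonneg j k
  have a3 := P.wedge_edge_pos j
  have a4 : P.height (P.prev j) (P.vertex k) ≠ 0 ∨ P.height j (P.vertex k) ≠ 0 := by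
    by_contra! hc
    rw [height_vertex_eq_zero, height_vertex_eq_zero] at hc
    obtain ⟨c1, c2⟩ := hc
    rcases c2 with c2 | c2
    · exact hk c2.symm
    · rcases c1 with c1 | c1
      · apply P.next_ne_prev j
        rw [c1, c2, next_prev]
      · exact hk ((finRotate P.n).symm.injective c1).symm
  have a5 : 0 < P.height (P.prev j) (P.vertex k) * f (P.edge j)
      - P.height j (P.vertex k) * f (P.edge (P.prev j)) := by
    rcases a4 with a4 | a4
    · have := lt_of_le_of_ne a1 (Ne.symm a4)
      nlinarith [mul_pos this h2, mul_nonneg a2 (neg_nonneg.2 h1.le)]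
    · have := lt_of_le_of_ne a2 (Ne.symm a4)
      nlinarith [mul_pos this (neg_pos.2 h1), mul_nonneg a1 h2.le]
  rw [← h] at a5
  linarith [pos_of_mul_pos_right a5 a3.le]

/-- If the two sides at a corner do not both rise or both fall, the corner is a strict extremum of
the height by `lt_vertex_of_turn`, hence `lo` or `hi`. At all others `slopeAt_sub` has a positive
denominator. -/
theorem slopeAt_sub_neg {t : ℝ} (ht : ∀ j, tilt t (P.edge j) ≠ 0) {lo hi j : Fin P.n}
    (hlo : ∀ k, tilt t (P.vertex lo) ≤ tilt t (P.vertex k))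
    (hhi : ∀ k, tilt t (P.vertex k) ≤ tilt t (P.vertex hi)) (h1 : j ≠ lo) (h2 : j ≠ hi) :
    slopeAt t (P.edge j) - slopeAt t (P.edge (P.prev j)) < 0 := by
  rw [slopeAt_sub t (ht _) (ht _), neg_div, neg_lt_zero]
  refine div_pos (P.wedge_edge_pos j) ?_
  by_contra hn
  have hp := ht (P.prev j)
  have he := ht j
  rcases lt_or_gt_of_ne he with he | he
  · rcases lt_or_gt_of_ne hp with hp | hp
    · exact hn (mul_pos_of_neg_of_neg hp he)
    · have := P.lt_vertex_of_turn (-tilt t) (j := j) (k := hi) (by simpa using hp)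
        (by simpa using he) (Ne.symm h2)
      simp only [LinearMap.neg_apply] at this
      linarith [hhi j]
  · rcases lt_or_gt_of_ne hp with hp | hp
    · have := P.lt_vertex_of_turn (tilt t) (j := j) (k := lo) hp he (Ne.symm h1)
      linarith [hlo j]
    · exact hn (mul_pos hp he)

instance : Nonempty (Fin P.n) := ⟨⟨0, by have := P.three_le; omega⟩⟩

/-- The area is negative semidefinite on a hyperplane of the homology tiles. -/
theorem exists_pathArea_nonpos : ∃ φ : (Fin P.n → ℂ) →ₗ[ℝ] ℝ, ∀ v ∈ P.homologyTiles, φ v = 0 →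
    pathArea v ≤ 0 ∧ (pathArea v = 0 → ∀ j k, v j = v k) := by
  obtain ⟨t, ht⟩ := exists_tilt_ne_zero P.edge P.edge_ne_zero
  obtain ⟨lo, hlo⟩ := Finite.exists_min fun j => tilt t (P.vertex j)
  obtain ⟨hi, hhi⟩ := Finite.exists_max fun j => tilt t (P.vertex j)
  -- With the corner `lo` translated to the origin, the vanishing of `φ` puts `hi` at height zero
  -- too, which removes the only two coefficients that may be positive.
  refine ⟨(tilt t).comp (LinearMap.proj (R := ℝ) (φ := fun _ => ℂ) hi -
    LinearMap.proj (R := ℝ) (φ := fun _ => ℂ) lo), fun v hv h0 => ?_⟩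
  have h0 : tilt t (v hi - v lo) = 0 := h0
  rw [← pathArea_sub_const v (v lo),
    pathArea_eq_sum_slopeAt ht (sub_const_mem_homologyTiles hv (v lo))]
  have hle : ∀ j ∈ Finset.univ, (slopeAt t (P.edge j) - slopeAt t (P.edge (P.prev j))) / 2
      * tilt t (v j - v lo) ^ 2 ≤ 0 := by
    intro j _
    by_cases h1 : j = lo
    · simp [h1]
    · by_cases h2 : j = hi
      · simp [h2, h0]
      · nlinarith [P.slopeAt_sub_neg ht hlo hhi h1 h2, sq_nonneg (tilt t (v j - v lo))]
  refine ⟨Finset.sum_nonpos hle, fun hz => ?_⟩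
  rw [Finset.sum_eq_zero_iff_of_nonpos hle] at hz
  -- In the equality case all corners have the same height, and since no side of `P` is horizontal
  -- every side of the path collapses.
  have hall : ∀ j, tilt t (v j) = tilt t (v lo) := by
    intro j
    rw [← sub_eq_zero, ← map_sub]
    by_cases h1 : j = lo
    · simp [h1]
    · by_cases h2 : j = hi
      · simp [h2, h0]
      · have h3 := P.slopeAt_sub_neg ht hlo hhi h1 h2
        have := hz j (Finset.mem_univ _)
        rcases mul_eq_zero.1 this with h | h
        · linarith
        · exact pow_eq_zero_iff two_ne_zero |>.1 h
  refine P.eq_of_next_eq fun j => ?_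
  obtain ⟨a, ha⟩ := hv j
  have h4 := congrArg (tilt t) ha
  rw [map_sub, hall, hall j, sub_self, map_smul] at h4
  have : a = 0 := by
    rcases smul_eq_zero.1 h4.symm with h | h
    · exact h
    · exact absurd h (ht j)
  rw [this, zero_smul, sub_eq_zero] at ha
  exact ha

variable {P}

/-- The area form on homology tiles has only one positive direction. -/
theorem pathArea_of_areaForm_eq_zero {u v : Fin P.n → ℂ} (hu : u ∈ P.homologyTiles)
    (hv : v ∈ P.homologyTiles) (hpos : 0 < pathArea u) (h : areaForm P.n u v = 0) :
    pathArea v ≤ 0 ∧ (pathArea v = 0 → ∀ j k, v j = v k) := by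
  obtain ⟨φ, hφ⟩ := P.exists_pathArea_nonpos
  have hφu : φ u ≠ 0 := fun h0 => (hφ u hu h0).1.not_gt hpos
  -- This combination is killed by `φ`. As `u` and `v` are orthogonal, its area has no cross term.
  have h1 := (hφ (φ v • u - φ u • v) (sub_mem_homologyTiles (smul_mem_homologyTiles _ hu)
    (smul_mem_homologyTiles _ hv)) (by simp; ring)).1
  have h2 : pathArea (φ v • u - φ u • v) = φ v ^ 2 * pathArea u + φ u ^ 2 * pathArea v := by
    rw [sub_eq_add_neg, ← neg_smul, pathArea_add, pathArea_smul, pathArea_smul]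
    simp [h]
  rw [h2] at h1
  have h3 : 0 < φ u ^ 2 := by positivity
  have h4 : 0 ≤ φ v ^ 2 * pathArea u := by positivity
  refine ⟨by nlinarith, fun h0 => ?_⟩
  have h5 : φ v ^ 2 * pathArea u = 0 := by rw [h0] at h1; linarith
  have h6 : φ v = 0 := by
    rcases mul_eq_zero.1 h5 with h | h
    · exact pow_eq_zero_iff two_ne_zero |>.1 h
    · exact absurd h hpos.ne'
  exact (hφ v hv h6).2 h0

/-- The combination of `u` and `v` orthogonal to `t` has nonpositive area; expanding it bounds the
product of the three polar values below by a positive number. The positive paths on the side of `t`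
behave like a half light cone. -/
theorem areaForm_pos {t u v : Fin P.n → ℂ} (ht : t ∈ P.homologyTiles) (hu : u ∈ P.homologyTiles)
    (hv : v ∈ P.homologyTiles) (htt : 0 < pathArea t) (huu : 0 < pathArea u)
    (hvv : 0 < pathArea v) (htu : 0 < areaForm P.n t u) (htv : 0 < areaForm P.n t v) :
    0 < areaForm P.n u v := by
  have h := (pathArea_of_areaForm_eq_zero (v := areaForm P.n t v • u - areaForm P.n t u • v)
    ht (sub_mem_homologyTiles (smul_mem_homologyTiles _ hu) (smul_mem_homologyTiles _ hv)) htt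
    (by simp; ring)).1
  rw [sub_eq_add_neg, ← neg_smul, pathArea_add, pathArea_smul, pathArea_smul] at h
  simp only [map_smul, LinearMap.smul_apply, smul_eq_mul] at h
  have h1 : 0 < areaForm P.n t v ^ 2 * pathArea u := by positivity
  have h2 : 0 < areaForm P.n t u ^ 2 * pathArea v := by positivity
  have h3 : 0 < areaForm P.n t v * areaForm P.n t u := by positivity
  by_contra hn
  nlinarith [mul_nonneg h3.le (sub_nonneg.2 (not_lt.1 hn))]

-- Cut the polygon into triangles from one corner: their doubled areas are the heights of that
-- corner over the sides.
variable (P) in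
theorem pathArea_vertex_pos : 0 < pathArea P.vertex := by
  let o : Fin P.n := Classical.arbitrary _
  rw [pathArea_eq_sum_wedge _ (P.vertex o)]
  have e : ∀ j, wedge (P.vertex j - P.vertex o) (P.vertex (finRotate P.n j) - P.vertex o) / 2
      = P.height j (P.vertex o) / 2 := by
    intro j
    simp only [height, edge, wedge, Complex.sub_re, Complex.sub_im]; ring
  simp only [e]
  refine Finset.sum_pos' (fun j _ => by linarith [P.height_vertex_nonneg j o])
    ⟨finRotate P.n o, Finset.mem_univ _, ?_⟩
  have := P.height_vertex_pos (j := finRotate P.n o) (k := o) (P.next_ne o).symm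
    (P.next_next_ne o).symm
  linarith

theorem continuous_areaForm_right {n : ℕ} (u : Fin n → ℂ) : Continuous (areaForm n u) :=
  LinearMap.continuous_of_finiteDimensional _

/-- The polar form against `P.vertex` cannot vanish on paths of positive area, so its sign is
constant on the component. Conversely, when it is positive the straight segment from `P.vertex` to
`u` consists of paths of positive area. -/
theorem sameOrientation_iff {u : Fin P.n → ℂ} (hpos : 0 < pathArea u) :
    P.SameOrientation u ↔ u ∈ P.homologyTiles ∧ 0 < areaForm P.n P.vertex u := by
  have hv : P.vertex ∈ {u | u ∈ P.homologyTiles ∧ 0 < pathArea u} :=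
    ⟨P.vertex_mem_homologyTiles, P.pathArea_vertex_pos⟩
  constructor
  · intro h
    refine ⟨(connectedComponentIn_subset _ _ h).1, ?_⟩
    by_contra hn
    have hc := (isPreconnected_connectedComponentIn (x := P.vertex)
      (F := {u | u ∈ P.homologyTiles ∧ 0 < pathArea u})).image _
      (continuous_areaForm_right P.vertex).continuousOn
    have h0 : (0 : ℝ) ∈ areaForm P.n P.vertex '' connectedComponentIn
        {u | u ∈ P.homologyTiles ∧ 0 < pathArea u} P.vertex := by
      refine hc.ordConnected.out ⟨u, h, rfl⟩ ⟨P.vertex, mem_connectedComponentIn hv, rfl⟩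
        ⟨not_lt.1 hn, ?_⟩
      rw [areaForm_self]
      exact P.pathArea_vertex_pos.le
    obtain ⟨w, hw, hw0⟩ := h0
    have hw' := connectedComponentIn_subset _ _ hw
    exact (pathArea_of_areaForm_eq_zero P.vertex_mem_homologyTiles hw'.1 P.pathArea_vertex_pos
      hw0).1.not_gt hw'.2
  · rintro ⟨h1, h2⟩
    have hsub : segment ℝ P.vertex u ⊆ {u | u ∈ P.homologyTiles ∧ 0 < pathArea u} := by
      rintro _ ⟨a, b, ha, hb, hab, rfl⟩
      refine ⟨add_mem_homologyTiles (smul_mem_homologyTiles _ P.vertex_mem_homologyTiles)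
        (smul_mem_homologyTiles _ h1), ?_⟩
      rw [pathArea_add, pathArea_smul, pathArea_smul]
      simp only [map_smul, LinearMap.smul_apply, smul_eq_mul]
      have h3 := P.pathArea_vertex_pos
      rcases ha.eq_or_lt with rfl | ha
      · have : b = 1 := by linarith
        subst this
        simpa using hpos
      · have e1 : 0 < a ^ 2 * pathArea P.vertex := by positivity
        have e2 : 0 ≤ b ^ 2 * pathArea u := by positivity
        have e3 : 0 ≤ 2 * (b * (a * areaForm P.n P.vertex u)) := by positivity
        have e4 : 0 ≤ 2 * (a * (b * areaForm P.n P.vertex u)) := by positivity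
        linarith
    exact (convex_segment _ _).isPreconnected.subset_connectedComponentIn
      (left_mem_segment ℝ _ _) hsub (right_mem_segment ℝ _ _)

end ConvexPolygon

/-! ### Maximal segments of a compact set -/

theorem image_uIcc_eq_segment (z d : ℂ) (α β : ℝ) :
    (fun s : ℝ => z + s • d) '' Set.uIcc α β = segment ℝ (z + α • d) (z + β • d) := by
  have h := image_segment ℝ (AffineMap.lineMap z (z + d) : ℝ →ᵃ[ℝ] ℂ) α β
  rw [segment_eq_uIcc] at h
  have e : ∀ s : ℝ, AffineMap.lineMap z (z + d) s = z + s • d := fun s => by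
    simp [AffineMap.lineMap_apply, add_comm]
  simpa only [e] using h

theorem exists_smul_of_mem_segment {x y p : ℂ} (hp : p ∈ segment ℝ x y) :
    ∃ s : ℝ, 0 ≤ s ∧ s ≤ 1 ∧ p = x + s • (y - x) := by
  rw [segment_eq_image'] at hp
  obtain ⟨s, hs, rfl⟩ := hp
  exact ⟨s, hs.1, hs.2, rfl⟩

theorem segment_subset_of_dist_le {x y x' y' : ℂ} (hx : x ∈ segment ℝ x' y')
    (hy : y ∈ segment ℝ x' y') (h : dist x' y' ≤ dist x y) :
    segment ℝ x' y' ⊆ segment ℝ x y := by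
  obtain ⟨s, hs0, hs1, rfl⟩ := exists_smul_of_mem_segment hx
  obtain ⟨t, ht0, ht1, rfl⟩ := exists_smul_of_mem_segment hy
  by_cases hd : y' = x'
  · subst hd; simp
  have hpos : 0 < ‖y' - x'‖ := norm_pos_iff.2 (sub_ne_zero.2 hd)
  rw [dist_eq_norm, dist_eq_norm, add_sub_add_left_eq_sub, ← sub_smul, norm_smul, norm_sub_rev,
    le_mul_iff_one_le_left hpos, Real.norm_eq_abs, le_abs] at h
  rcases h with h | h
  · have h1 : s = 1 := by linarith
    have h2 : t = 0 := by linarith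
    subst h1 h2
    rw [segment_symm]; simp
  · have h1 : s = 0 := by linarith
    have h2 : t = 1 := by linarith
    subst h1 h2
    simp

/-- Every nontrivial segment in a compact set is contained in a maximal one. -/
theorem exists_maximal_segment {U : Set ℂ} (hU : IsCompact U) {a b : ℂ} (hab : a ≠ b)
    (h : segment ℝ a b ⊆ U) : ∃ S : Set ℂ, segment ℝ a b ⊆ S ∧
      Maximal (fun S : Set ℂ => (∃ x y : ℂ, x ≠ y ∧ S = segment ℝ x y) ∧ S ⊆ U) S := by
  -- Endpoint pairs of segments in `U` through `a` and `b`. Betweenness is written with distances so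
  -- that the set is visibly closed; a longest such segment is then maximal.
  let C : Set (ℂ × ℂ) := {p | (∀ t ∈ Set.Icc (0 : ℝ) 1, AffineMap.lineMap p.1 p.2 t ∈ U) ∧
    dist p.1 a + dist a p.2 = dist p.1 p.2 ∧ dist p.1 b + dist b p.2 = dist p.1 p.2}
  have hmem : ∀ x y, (x, y) ∈ C ↔
      segment ℝ x y ⊆ U ∧ a ∈ segment ℝ x y ∧ b ∈ segment ℝ x y := by
    intro x y
    have hd : ∀ p : ℂ, dist x p + dist p y = dist x y ↔ p ∈ segment ℝ x y := fun p => by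
      rw [mem_segment_iff_wbtw, dist_add_dist_eq_iff]
    rw [← hd, ← hd, segment_eq_image_lineMap, Set.image_subset_iff]
    rfl
  have hC : IsCompact C := by
    refine (hU.prod hU).of_isClosed_subset ?_ ?_
    · have e : C = (⋂ t ∈ Set.Icc (0 : ℝ) 1, {p : ℂ × ℂ | AffineMap.lineMap p.1 p.2 t ∈ U}) ∩
          ({p : ℂ × ℂ | dist p.1 a + dist a p.2 = dist p.1 p.2} ∩
            {p : ℂ × ℂ | dist p.1 b + dist b p.2 = dist p.1 p.2}) := by
        ext p
        simp [C]
      rw [e]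
      refine IsClosed.inter ?_ (IsClosed.inter (isClosed_eq (by fun_prop) (by fun_prop))
        (isClosed_eq (by fun_prop) (by fun_prop)))
      refine isClosed_biInter fun t _ => hU.isClosed.preimage ?_
      simp only [AffineMap.lineMap_apply_module]
      fun_prop
    · rintro ⟨x, y⟩ hp
      rw [hmem] at hp
      exact ⟨hp.1 (left_mem_segment ℝ _ _), hp.1 (right_mem_segment ℝ _ _)⟩
  obtain ⟨⟨x, y⟩, hxy, hmax⟩ := hC.exists_isMaxOn
    ⟨(a, b), (hmem a b).2 ⟨h, left_mem_segment ℝ _ _, right_mem_segment ℝ _ _⟩⟩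
    (f := fun p => dist p.1 p.2) (by fun_prop)
  obtain ⟨h1, h2, h3⟩ := (hmem x y).1 hxy
  refine ⟨segment ℝ x y, (convex_segment x y).segment_subset h2 h3, ⟨⟨x, y, ?_, rfl⟩, h1⟩, ?_⟩
  · rintro rfl
    rw [segment_same] at h2 h3
    exact hab (h2.trans h3.symm)
  · rintro _ ⟨⟨x', y', -, rfl⟩, hU'⟩ hle
    have hle' : segment ℝ x y ⊆ segment ℝ x' y' := hle
    refine segment_subset_of_dist_le (hle' (left_mem_segment ℝ _ _))
      (hle' (right_mem_segment ℝ _ _)) ?_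
    exact hmax ((hmem x' y').2 ⟨hU', hle' h2, hle' h3⟩)

/-- A maximal segment of a set absorbs every parallel segment of the set that meets it. -/
theorem segment_subset_of_maximal {U : Set ℂ} {x y c d z : ℂ} {r : ℝ} (hxy : x ≠ y)
    (hmax : Maximal (fun S : Set ℂ => (∃ x y : ℂ, x ≠ y ∧ S = segment ℝ x y) ∧ S ⊆ U)
      (segment ℝ x y)) (hz : z ∈ segment ℝ x y) (hz' : z ∈ segment ℝ c d)
    (hcd : segment ℝ c d ⊆ U) (hr : d - c = r • (y - x)) :
    segment ℝ c d ⊆ segment ℝ x y := by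
  obtain ⟨σ, hσ0, hσ1, hσ⟩ := exists_smul_of_mem_segment hz
  obtain ⟨τ, hτ0, hτ1, hτ⟩ := exists_smul_of_mem_segment hz'
  rw [hr, smul_smul] at hτ
  have ex : x = z + (-σ) • (y - x) := by rw [hσ, neg_smul]; ring
  have ey : y = z + (1 - σ) • (y - x) := by rw [hσ, sub_smul, one_smul]; ring
  have ec : c = z + (-(τ * r)) • (y - x) := by rw [hτ, neg_smul]; ring
  have ed : d = z + ((1 - τ) * r) • (y - x) := by
    rw [sub_mul, sub_smul, one_mul, ← hr, hτ]; ring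
  have hb : segment ℝ x y = (fun s : ℝ => z + s • (y - x)) '' Set.uIcc (-σ) (1 - σ) := by
    rw [image_uIcc_eq_segment, ← ex, ← ey]
  have hs : segment ℝ c d
      = (fun s : ℝ => z + s • (y - x)) '' Set.uIcc (-(τ * r)) ((1 - τ) * r) := by
    rw [image_uIcc_eq_segment, ← ec, ← ed]
  set I := Set.uIcc (-σ) (1 - σ)
  set J := Set.uIcc (-(τ * r)) ((1 - τ) * r)
  have h0I : (0 : ℝ) ∈ I := Set.mem_uIcc.2 (Or.inl ⟨by linarith, by linarith⟩)
  have h0J : (0 : ℝ) ∈ J := by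
    refine Set.mem_uIcc.2 ?_
    rcases le_total 0 r with h | h
    · exact Or.inl ⟨by nlinarith, by nlinarith⟩
    · exact Or.inr ⟨by nlinarith, by nlinarith⟩
  -- Both parameter intervals contain 0, so their union is a compact interval and the union of the
  -- two segments is again a segment in `U`.
  have hIJ : Set.OrdConnected (I ∪ J) := by
    have hI : IsPreconnected I := isPreconnected_uIcc
    have hJ : IsPreconnected J := isPreconnected_uIcc
    exact (hI.union 0 h0I h0J hJ).ordConnected
  have hcpt : IsCompact (I ∪ J) := isCompact_uIcc.union isCompact_uIcc
  have hne : (I ∪ J).Nonempty := ⟨0, Or.inl h0I⟩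
  have hun : I ∪ J = Set.uIcc (sInf (I ∪ J)) (sSup (I ∪ J)) := by
    have hle : sInf (I ∪ J) ≤ sSup (I ∪ J) :=
      (csInf_le hcpt.bddBelow hne.some_mem).trans (le_csSup hcpt.bddAbove hne.some_mem)
    rw [Set.uIcc_of_le hle]
    exact Set.Subset.antisymm
      (fun s hs => ⟨csInf_le hcpt.bddBelow hs, le_csSup hcpt.bddAbove hs⟩)
      (hIJ.out (hcpt.sInf_mem hne) (hcpt.sSup_mem hne))
  have hS : segment ℝ x y ∪ segment ℝ c d = segment ℝ (z + sInf (I ∪ J) • (y - x))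
      (z + sSup (I ∪ J) • (y - x)) := by
    rw [hb, hs, ← Set.image_union, ← image_uIcc_eq_segment, ← hun]
  refine Set.subset_union_right.trans
    (hmax.2 ⟨⟨_, _, ?_, hS⟩, Set.union_subset hmax.1.2 hcd⟩ Set.subset_union_left)
  intro heq
  rw [← heq, segment_same] at hS
  have h1 : x ∈ segment ℝ x y ∪ segment ℝ c d := Or.inl (left_mem_segment ℝ _ _)
  have h2 : y ∈ segment ℝ x y ∪ segment ℝ c d := Or.inl (right_mem_segment ℝ _ _)
  rw [hS] at h1 h2
  exact hxy (h1.trans h2.symm)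

/-! ### The segments of a tiling -/

namespace ConvexTiling

variable {R : ConvexPolygon} {W : Type*} (T : ConvexTiling R W)

/-- The union of the tile boundaries. -/
def skeleton : Set ℂ := ⋃ w, frontier (T.tile w).region

theorem isCompact_skeleton [Finite W] : IsCompact T.skeleton :=
  isCompact_iUnion fun w => (T.tile w).isCompact_region.of_isClosed_subset isClosed_frontier
    (T.tile w).isClosed_region.frontier_subset

theorem side_subset_skeleton (w : W) (j) : (T.tile w).side j ⊆ T.skeleton := by
  refine Set.Subset.trans ?_ (Set.subset_iUnion _ w)
  rw [ConvexPolygon.frontier_region]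
  exact Set.subset_iUnion _ j

theorem tile_subset (w : W) : (T.tile w).region ⊆ R.region :=
  T.cover ▸ Set.subset_iUnion (fun w => (T.tile w).region) w

theorem skeleton_subset : T.skeleton ⊆ R.region :=
  Set.iUnion_subset fun w => ((T.tile w).isClosed_region.frontier_subset).trans (T.tile_subset w)

theorem exists_black_endpoints (b : T.Black) :
    ∃ x d : ℂ, d ≠ 0 ∧ b.1 = segment ℝ x (x + d) := by
  obtain ⟨⟨⟨x, y, hxy, h⟩, -⟩, -⟩ := b.2
  exact ⟨x, y - x, sub_ne_zero.2 hxy.symm, by rw [h]; congr 1; ring⟩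

/-- An endpoint of a maximal segment. -/
noncomputable def base (b : T.Black) : ℂ := (T.exists_black_endpoints b).choose

/-- The direction of a maximal segment. -/
noncomputable def dir (b : T.Black) : ℂ := (T.exists_black_endpoints b).choose_spec.choose

theorem dir_ne_zero (b : T.Black) : T.dir b ≠ 0 :=
  (T.exists_black_endpoints b).choose_spec.choose_spec.1

theorem black_eq_segment (b : T.Black) : b.1 = segment ℝ (T.base b) (T.base b + T.dir b) :=
  (T.exists_black_endpoints b).choose_spec.choose_spec.2

theorem base_mem (b : T.Black) : T.base b ∈ b.1 := by
  rw [black_eq_segment]; exact left_mem_segment ℝ _ _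

theorem base_add_dir_mem (b : T.Black) : T.base b + T.dir b ∈ b.1 := by
  rw [black_eq_segment]; exact right_mem_segment ℝ _ _

theorem black_subset (b : T.Black) : b.1 ⊆ T.skeleton := b.2.1.2

theorem wedge_dir_sub {b : T.Black} {p q : ℂ} (hp : p ∈ b.1) (hq : q ∈ b.1) :
    wedge (T.dir b) (q - p) = 0 := by
  rw [black_eq_segment] at hp hq
  obtain ⟨s, -, -, rfl⟩ := exists_smul_of_mem_segment hp
  obtain ⟨t, -, -, rfl⟩ := exists_smul_of_mem_segment hq
  rw [add_sub_add_left_eq_sub, add_sub_cancel_left, ← sub_smul, wedge_smul_right, wedge_self,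
    mul_zero]

theorem exists_sub_eq_smul_dir {b : T.Black} {p q : ℂ} (hp : p ∈ b.1) (hq : q ∈ b.1) :
    ∃ r : ℝ, q - p = r • T.dir b :=
  exists_smul_of_wedge_eq_zero (T.dir_ne_zero b) (T.wedge_dir_sub hp hq)

variable {T}

theorem segment_subset_black {b : T.Black} {c d z : ℂ} {r : ℝ} (hz : z ∈ b.1)
    (hz' : z ∈ segment ℝ c d) (hcd : segment ℝ c d ⊆ T.skeleton) (hr : d - c = r • T.dir b) :
    segment ℝ c d ⊆ b.1 := by
  have hb : T.IsMaximalSegment b.1 := b.2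
  unfold IsMaximalSegment at hb
  rw [T.black_eq_segment b] at hb hz ⊢
  refine segment_subset_of_maximal (r := r) ?_ hb hz hz' hcd ?_
  · simpa using T.dir_ne_zero b
  · rw [hr]; congr 1; ring

/-- Two common points make the maximal segments parallel, and then each absorbs the other. -/
theorem black_eq_of_mem {b b' : T.Black} {p q : ℂ} (hpq : p ≠ q) (hp : p ∈ b.1) (hq : q ∈ b.1)
    (hp' : p ∈ b'.1) (hq' : q ∈ b'.1) : b = b' := by
  have key : ∀ b b' : T.Black, p ∈ b.1 → q ∈ b.1 → p ∈ b'.1 → q ∈ b'.1 → b'.1 ⊆ b.1 := by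
    intro b b' hp hq hp' hq'
    obtain ⟨r, hr⟩ := T.exists_sub_eq_smul_dir hp hq
    obtain ⟨r', hr'⟩ := T.exists_sub_eq_smul_dir hp' hq'
    have hr0 : r' ≠ 0 := by
      rintro rfl
      rw [zero_smul, sub_eq_zero] at hr'
      exact hpq hr'.symm
    have h1 := T.black_subset b'
    rw [T.black_eq_segment b'] at hp' h1 ⊢
    refine segment_subset_black (r := r'⁻¹ * r) hp hp' h1 ?_
    rw [mul_smul, ← hr, hr', smul_smul, inv_mul_cancel₀ hr0, one_smul, add_sub_cancel_left]
  exact Subtype.ext (Set.Subset.antisymm (key b' b hp' hq' hp hq) (key b b' hp hq hp' hq'))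

theorem black_eq_of_side_subset {b b' : T.Black} {w : W} {j : Fin (T.tile w).n}
    (h : (T.tile w).side j ⊆ b.1) (h' : (T.tile w).side j ⊆ b'.1) : b = b' :=
  black_eq_of_mem (fun hc => (T.tile w).next_ne j ((T.tile w).vertex_injective hc).symm)
    (h (left_mem_segment ℝ _ _)) (h (right_mem_segment ℝ _ _))
    (h' (left_mem_segment ℝ _ _)) (h' (right_mem_segment ℝ _ _))

variable (T)

theorem exists_black [Finite W] (w : W) (j) : ∃ b : T.Black, (T.tile w).side j ⊆ b.1 := by
  obtain ⟨S, hS, hmax⟩ := exists_maximal_segment T.isCompact_skeleton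
    (fun hc => (T.tile w).next_ne j ((T.tile w).vertex_injective hc).symm)
    (T.side_subset_skeleton w j)
  exact ⟨⟨S, hmax⟩, hS⟩

/-- The maximal segment that carries a side of a tile. -/
noncomputable def black [Finite W] (w : W) (j : Fin (T.tile w).n) : T.Black :=
  (T.exists_black w j).choose

section

variable [Finite W]

theorem side_subset_black (w : W) (j) : (T.tile w).side j ⊆ (T.black w j).1 :=
  (T.exists_black w j).choose_spec

variable {T} in
theorem black_eq {w : W} {j} {b : T.Black} (h : (T.tile w).side j ⊆ b.1) : T.black w j = b :=
  black_eq_of_side_subset (T.side_subset_black w j) h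

theorem vertex_mem_black (w : W) (j) : (T.tile w).vertex j ∈ (T.black w j).1 :=
  T.side_subset_black w j (left_mem_segment ℝ _ _)

theorem vertex_next_mem_black (w : W) (j) :
    (T.tile w).vertex (finRotate _ j) ∈ (T.black w j).1 :=
  T.side_subset_black w j (right_mem_segment ℝ _ _)

theorem vertex_mem_black_prev (w : W) (j) :
    (T.tile w).vertex j ∈ (T.black w ((T.tile w).prev j)).1 := by
  have := T.vertex_next_mem_black w ((T.tile w).prev j)
  rwa [ConvexPolygon.next_prev] at this

theorem exists_edge_eq_smul_dir (w : W) (j) :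
    ∃ r : ℝ, r ≠ 0 ∧ (T.tile w).edge j = r • T.dir (T.black w j) := by
  obtain ⟨r, hr⟩ := T.exists_sub_eq_smul_dir (T.vertex_mem_black w j)
    (T.vertex_next_mem_black w j)
  refine ⟨r, ?_, hr⟩
  rintro rfl
  exact (T.tile w).edge_ne_zero j (by rw [ConvexPolygon.edge, hr, zero_smul])

theorem wedge_dir_ne_zero (w : W) (j) :
    wedge (T.dir (T.black w ((T.tile w).prev j))) (T.dir (T.black w j)) ≠ 0 := by
  obtain ⟨r, -, hr⟩ := T.exists_edge_eq_smul_dir w j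
  obtain ⟨r', -, hr'⟩ := T.exists_edge_eq_smul_dir w ((T.tile w).prev j)
  have := (T.tile w).wedge_edge_pos j
  rw [hr, hr', wedge_smul_left, wedge_smul_right] at this
  intro h0
  rw [h0] at this
  simp at this

theorem black_prev_ne (w : W) (j) : T.black w ((T.tile w).prev j) ≠ T.black w j := fun h => by
  have := T.wedge_dir_ne_zero w j
  rw [h, wedge_self] at this
  exact this rfl

variable {T} in
/-- Parallel sides of tiles that share a point lie on the same maximal segment. -/
theorem black_eq_black {w w' : W} {j j'} {z : ℂ} {r : ℝ} (hz : z ∈ (T.tile w).side j)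
    (hz' : z ∈ (T.tile w').side j') (h : (T.tile w').edge j' = r • (T.tile w).edge j) :
    T.black w' j' = T.black w j := by
  obtain ⟨s, -, hs⟩ := T.exists_edge_eq_smul_dir w j
  exact black_eq (segment_subset_black (r := r * s) (T.side_subset_black w j hz) hz'
    (T.side_subset_skeleton w' j') (by rw [mul_smul, ← hs, ← h]; rfl))

/-- Finitely many sides cover the infinite set `b`, so one of them shares two points with it.
Consequently there are finitely many segments. -/
theorem exists_side_subset (b : T.Black) : ∃ w j, T.black w j = b := by
  have hinf : b.1.Infinite := by
    rw [black_eq_segment, segment_eq_image']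
    refine (Set.Icc_infinite (zero_lt_one' ℝ)).image ?_
    intro s _ t _ h
    simpa [T.dir_ne_zero b] using h
  have hsub : b.1 = ⋃ i : Σ w, Fin (T.tile w).n, b.1 ∩ (T.tile i.1).side i.2 := by
    rw [← Set.inter_iUnion, eq_comm, Set.inter_eq_left]
    intro z hz
    obtain ⟨w, hw⟩ := Set.mem_iUnion.1 (T.black_subset b hz)
    rw [ConvexPolygon.frontier_region] at hw
    obtain ⟨j, hj⟩ := Set.mem_iUnion.1 hw
    exact Set.mem_iUnion.2 ⟨⟨w, j⟩, hj⟩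
  have hex : ∃ i : Σ w, Fin (T.tile w).n, (b.1 ∩ (T.tile i.1).side i.2).Infinite := by
    by_contra! hc
    rw [hsub] at hinf
    exact hinf (Set.finite_iUnion hc)
  obtain ⟨⟨w, j⟩, hi⟩ := hex
  obtain ⟨p, hp, q, hq, hpq⟩ := hi.nontrivial
  exact ⟨w, j, black_eq_of_mem hpq (T.side_subset_black w j hp.2) (T.side_subset_black w j hq.2)
    hp.1 hq.1⟩

instance : Finite T.Black :=
  Finite.of_surjective (fun i : Σ w, Fin (T.tile w).n => T.black i.1 i.2) fun b => by
    obtain ⟨w, j, h⟩ := T.exists_side_subset b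
    exact ⟨⟨w, j⟩, h⟩

end

variable {T} in
/-- A maximal segment that is parallel to a side of `R` and meets it is a boundary segment. -/
theorem isBoundary_of_parallel {b : T.Black} {z : ℂ} {k} (hz : z ∈ b.1) (hz' : z ∈ R.side k)
    (h : wedge (R.edge k) (T.dir b) = 0) : T.IsBoundary b := by
  intro p hp
  rw [ConvexPolygon.frontier_region]
  refine Set.mem_iUnion.2 ⟨k, R.mem_side_iff.2 ⟨T.skeleton_subset (T.black_subset b hp), ?_⟩⟩
  obtain ⟨r, hr⟩ := T.exists_sub_eq_smul_dir hz hp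
  have e : p = z + r • T.dir b := by rw [← hr]; ring
  rw [e, ConvexPolygon.height_add_smul, (R.mem_side_iff.1 hz').2, h]; simp

end ConvexTiling

/-! ### Sectors and directions at a point -/

open Filter in
theorem eventually_add_mul_neg {a : ℝ} (ha : a < 0) (b : ℝ) :
    ∀ᶠ s in nhdsWithin (0 : ℝ) (Set.Ioi 0), a + s * b < 0 := by
  have h : Continuous fun s : ℝ => a + s * b := by fun_prop
  have h' : Tendsto (fun s : ℝ => a + s * b) (nhds 0) (nhds a) := by simpa using h.tendsto 0
  exact (h'.eventually (gt_mem_nhds ha)).filter_mono nhdsWithin_le_nhds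

theorem nonneg_of_forall_add_mul {a b : ℝ} (h : ∀ s > 0, 0 ≤ a + s * b) : 0 ≤ a := by
  by_contra hn
  obtain ⟨s, hs, hs0⟩ := ((eventually_add_mul_neg (not_le.1 hn) b).and
    self_mem_nhdsWithin).exists
  exact (h s hs0).not_gt hs

theorem nonneg_or_nonneg_of_forall_add_mul {a b a' b' : ℝ}
    (h : ∀ s > 0, 0 ≤ a + s * b ∨ 0 ≤ a' + s * b') : 0 ≤ a ∨ 0 ≤ a' := by
  by_contra! hn
  obtain ⟨s, ⟨hs, hs'⟩, hs0⟩ := (((eventually_add_mul_neg hn.1 b).and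
    (eventually_add_mul_neg hn.2 b')).and self_mem_nhdsWithin).exists
  rcases h s hs0 with h | h <;> linarith

/-- Two convex sectors, with sides in the directions `a` and `-q`, that tile a half-plane are
separated by a ray. -/
theorem sectors_of_cover {h q a q' a' : ℂ} (hh : h ≠ 0) (hqa : 0 < wedge q a)
    (hqa' : 0 < wedge q' a') (ha : 0 ≤ wedge h a) (ha' : 0 ≤ wedge h a') (hq : wedge h q ≤ 0)
    (hq' : wedge h q' ≤ 0) (hcov : ∀ d, 0 < wedge h d →
      (0 ≤ wedge q d ∧ 0 ≤ wedge a d) ∨ (0 ≤ wedge q' d ∧ 0 ≤ wedge a' d))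
    (hdisj : ∀ d, 0 < wedge q d → 0 < wedge a d → 0 < wedge q' d → 0 < wedge a' d → False)
    (h0 : wedge h a = 0) :
    (∃ κ : ℝ, 0 < κ ∧ a = κ • q') ∧ (∃ ν : ℝ, 0 < ν ∧ q = (-ν) • a') ∧ 0 < wedge h a' := by
  obtain ⟨l, rfl⟩ := exists_smul_of_wedge_eq_zero hh h0
  rw [wedge_smul_right, wedge_swap] at hqa
  have hl : 0 < l := by
    by_contra hn
    nlinarith
  have hq0 : wedge h q < 0 := by
    refine lt_of_le_of_ne hq fun h => ?_
    rw [h] at hqa; simp at hqa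
  have hI := wedge_I_mul_pos hh
  -- Directions just inside the half-plane next to `-h` cannot lie in the first sector, so the
  -- second one reaches `-h`.
  have h1 : wedge h q' = 0 := by
    have := nonneg_or_nonneg_of_forall_add_mul (a := wedge h q) (a' := wedge h q')
      (b := wedge q (Complex.I * h)) (b' := wedge q' (Complex.I * h)) (by
        intro s hs
        have hd := hcov (-h + s • (Complex.I * h)) (by
          rw [wedge_add_right, wedge_neg_right, wedge_self, wedge_smul_right]
          have := mul_pos hs hI
          linarith)
        simp only [wedge_add_right, wedge_neg_right, wedge_smul_right] at hd
        rw [wedge_swap h q, wedge_swap h q'] at hd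
        rcases hd with hd | hd
        · left; linarith [hd.1]
        · right; linarith [hd.1])
    rcases this with h | h
    · linarith
    · linarith
  obtain ⟨m, rfl⟩ := exists_smul_of_wedge_eq_zero hh h1
  rw [wedge_smul_left] at hqa'
  have hm : 0 < m := by
    by_contra hn
    nlinarith
  have ha0 : 0 < wedge h a' := pos_of_mul_pos_right hqa' hm.le
  -- The direction `-q + a'` lies in neither sector if there is a gap between them, and in the
  -- interior of both if they overlap.
  have h2 : wedge q a' = 0 := by
    have hd0 : 0 < wedge h (-q + a') := by
      rw [wedge_add_right, wedge_neg_right]; linarith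
    rcases lt_trichotomy (wedge q a') 0 with h | h | h
    · exfalso
      rcases hcov _ hd0 with hd | hd
      · have := hd.1
        rw [wedge_add_right, wedge_neg_right, wedge_self] at this
        linarith
      · have := hd.2
        rw [wedge_add_right, wedge_neg_right, wedge_self, wedge_swap] at this
        linarith
    · exact h
    · exfalso
      refine hdisj (-q + a') ?_ ?_ ?_ ?_
      · rw [wedge_add_right, wedge_neg_right, wedge_self]; linarith
      · rw [wedge_smul_left]; positivity
      · rw [wedge_smul_left]; positivity
      · rw [wedge_add_right, wedge_neg_right, wedge_self, wedge_swap]; linarith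
  refine ⟨⟨l / m, div_pos hl hm, ?_⟩, ?_, ha0⟩
  · rw [smul_smul, div_mul_cancel₀ _ hm.ne']
  · have h3 : wedge a' q = 0 := by rw [wedge_swap, h2, neg_zero]
    obtain ⟨r, rfl⟩ := exists_smul_of_wedge_eq_zero (ne_zero_of_wedge_right ha0.ne') h3
    rw [wedge_smul_right] at hq0
    exact ⟨-r, by by_contra hn; nlinarith, by rw [neg_neg]⟩

namespace ConvexPolygon

variable (P : ConvexPolygon)

/-- `d` points from the point `p` of the polygon into its interior. -/
def InnerDir (p d : ℂ) : Prop := ∀ j, P.height j p = 0 → 0 < wedge (P.edge j) d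

/-- `d` points from the point `p` of the polygon into the polygon. -/
def TangentDir (p d : ℂ) : Prop := ∀ j, P.height j p = 0 → 0 ≤ wedge (P.edge j) d

variable {P}

theorem eventually_height_pos {p d : ℂ} (hp : p ∈ P.region) {j} (h : P.height j p ≠ 0) :
    ∀ᶠ s in nhdsWithin (0 : ℝ) (Set.Ioi 0), 0 < P.height j (p + s • d) := by
  have h1 : 0 < P.height j p := lt_of_le_of_ne (P.mem_region_iff.1 hp j) (Ne.symm h)
  filter_upwards [eventually_add_mul_neg (neg_lt_zero.2 h1) (-wedge (P.edge j) d)] with s hs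
  rw [height_add_smul]; linarith

theorem eventually_mem_interior {p d : ℂ} (hp : p ∈ P.region) (h : P.InnerDir p d) :
    ∀ᶠ s in nhdsWithin (0 : ℝ) (Set.Ioi 0), p + s • d ∈ interior P.region := by
  simp only [mem_interior_iff]
  refine Filter.eventually_all.2 fun j => ?_
  by_cases h0 : P.height j p = 0
  · filter_upwards [self_mem_nhdsWithin] with s hs
    rw [height_add_smul, h0, zero_add]
    exact mul_pos hs (h j h0)
  · exact eventually_height_pos hp h0

theorem eventually_mem_region {p d : ℂ} (hp : p ∈ P.region) (h : P.TangentDir p d) :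
    ∀ᶠ s in nhdsWithin (0 : ℝ) (Set.Ioi 0), p + s • d ∈ P.region := by
  simp only [mem_region_iff]
  refine Filter.eventually_all.2 fun j => ?_
  by_cases h0 : P.height j p = 0
  · filter_upwards [self_mem_nhdsWithin] with s hs
    rw [height_add_smul, h0, zero_add]
    exact mul_nonneg (le_of_lt hs) (h j h0)
  · exact (eventually_height_pos hp h0).mono fun s hs => hs.le

theorem tangentDir_of_mem {p d : ℂ} {s : ℝ} (hs : 0 < s) (h : p + s • d ∈ P.region) :
    P.TangentDir p d := fun j h0 => by
  have := P.mem_region_iff.1 h j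
  rw [height_add_smul, h0, zero_add] at this
  exact nonneg_of_mul_nonneg_right this hs

theorem innerDir_of_mem {p d : ℂ} {s : ℝ} (hs : 0 < s) (h : p + s • d ∈ interior P.region) :
    P.InnerDir p d := fun j h0 => by
  have := P.mem_interior_iff.1 h j
  rw [height_add_smul, h0, zero_add] at this
  exact pos_of_mul_pos_right this hs.le

theorem innerDir_vertex {j : Fin P.n} {d : ℂ} : P.InnerDir (P.vertex j) d ↔
    0 < wedge (P.edge (P.prev j)) d ∧ 0 < wedge (P.edge j) d := by
  simp only [InnerDir, height_vertex_eq_zero]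
  exact ⟨fun h => ⟨h _ (Or.inr rfl), h _ (Or.inl rfl)⟩,
    fun h k hk => by rcases hk with rfl | rfl; exacts [h.2, h.1]⟩

theorem tangentDir_vertex {j : Fin P.n} {d : ℂ} : P.TangentDir (P.vertex j) d ↔
    0 ≤ wedge (P.edge (P.prev j)) d ∧ 0 ≤ wedge (P.edge j) d := by
  simp only [TangentDir, height_vertex_eq_zero]
  exact ⟨fun h => ⟨h _ (Or.inr rfl), h _ (Or.inl rfl)⟩,
    fun h k hk => by rcases hk with rfl | rfl; exacts [h.2, h.1]⟩

theorem innerDir_openSide {j : Fin P.n} {p d : ℂ} (hp : p ∈ P.openSide j) :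
    P.InnerDir p d ↔ 0 < wedge (P.edge j) d := by
  simp only [InnerDir, P.height_eq_zero_of_mem_openSide hp, forall_eq]

theorem tangentDir_openSide {j : Fin P.n} {p d : ℂ} (hp : p ∈ P.openSide j) :
    P.TangentDir p d ↔ 0 ≤ wedge (P.edge j) d := by
  simp only [TangentDir, P.height_eq_zero_of_mem_openSide hp, forall_eq]

theorem innerDir_vertex_edge_sub (j : Fin P.n) {s : ℝ} (hs : 0 < s) :
    P.InnerDir (P.vertex j) (P.edge j + s • -P.edge (P.prev j)) := by
  have := P.wedge_edge_pos j
  rw [innerDir_vertex]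
  simp only [wedge_add_right, wedge_smul_right, wedge_neg_right, wedge_self]
  rw [wedge_swap (P.edge (P.prev j)) (P.edge j)]
  constructor
  · linarith
  · have := mul_pos hs this
    linarith

theorem innerDir_vertex_sub_edge (j : Fin P.n) {s : ℝ} (hs : 0 < s) :
    P.InnerDir (P.vertex j) (-P.edge (P.prev j) + s • P.edge j) := by
  have := P.wedge_edge_pos j
  rw [innerDir_vertex]
  simp only [wedge_add_right, wedge_smul_right, wedge_neg_right, wedge_self]
  rw [wedge_swap (P.edge (P.prev j)) (P.edge j)]
  constructor
  · have := mul_pos hs this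
    linarith
  · linarith

theorem mem_openSide_of_height_eq_zero {p : ℂ} (hp : p ∈ P.region) (hc : p ∉ P.corners)
    {j : Fin P.n} (h : P.height j p = 0) : p ∈ P.openSide j := by
  refine mem_openSegment_of_ne_left_right ?_ ?_ (P.mem_side_iff.2 ⟨hp, h⟩)
  · rintro rfl; exact hc ⟨_, rfl⟩
  · rintro rfl; exact hc ⟨_, rfl⟩

theorem notMem_corners_of_mem_openSide {p : ℂ} {j : Fin P.n} (hp : p ∈ P.openSide j) :
    p ∉ P.corners := by
  rintro ⟨k, rfl⟩
  have h1 := (P.height_eq_zero_of_mem_openSide hp (k := k)).1 (P.height_self k)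
  have h2 := (P.height_eq_zero_of_mem_openSide hp (k := P.prev k)).1 (P.height_prev k)
  exact P.prev_ne k (h2.trans h1.symm)

variable (P) in
theorem region_subset_closure_interior : P.region ⊆ closure (interior P.region) := by
  obtain ⟨s, hs⟩ := (eventually_mem_interior (P.vertex_mem_region (Classical.arbitrary _))
    (innerDir_vertex_edge_sub _ one_pos)).exists
  rw [region, (convex_convexHull ℝ (Set.range P.vertex)).closure_interior_eq_closure_of_nonempty_interior
    ⟨_, hs⟩]
  exact subset_closure

end ConvexPolygon

/-! ### Local structure of the tiling at corners of tiles and of `R` -/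

namespace ConvexTiling

variable {R : ConvexPolygon} {W : Type*} {T : ConvexTiling R W}

/-- A tile is the closure of its interior, which upgrades disjointness of interiors to disjointness
of one interior from the other whole tile. -/
theorem notMem_region_of_mem_interior {w w' : W} (hw : w ≠ w') {z : ℂ}
    (hz : z ∈ interior (T.tile w).region) : z ∉ (T.tile w').region := fun hz' =>
  Set.disjoint_left.1 ((T.disjoint_interior w w' hw).closure_right isOpen_interior) hz
    ((T.tile w').region_subset_closure_interior hz')

theorem notMem_skeleton_of_mem_interior {w : W} {z : ℂ}
    (hz : z ∈ interior (T.tile w).region) : z ∉ T.skeleton := by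
  intro h
  obtain ⟨w', hw'⟩ := Set.mem_iUnion.1 h
  by_cases hww : w = w'
  · subst hww
    exact hw'.2 hz
  · exact notMem_region_of_mem_interior hww hz ((T.tile w').isClosed_region.frontier_subset hw')

/-- Finitely many tiles cover an initial piece of the ray, so one of them contains points of the ray
arbitrarily close to `p`. -/
theorem exists_tangentDir [Finite W] {p d : ℂ} (hp : p ∈ R.region) (hd : R.TangentDir p d) :
    ∃ w, p ∈ (T.tile w).region ∧ (T.tile w).TangentDir p d := by
  have h1 := ConvexPolygon.eventually_mem_region hp hd
  have h2 : ∃ w, ∃ᶠ s in nhdsWithin (0 : ℝ) (Set.Ioi 0), p + s • d ∈ (T.tile w).region := by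
    by_contra! hc
    obtain ⟨s, hs, hs'⟩ := (h1.and (Filter.eventually_all.2 hc)).exists
    rw [← T.cover] at hs
    obtain ⟨w, hw⟩ := Set.mem_iUnion.1 hs
    exact hs' w hw
  obtain ⟨w, hw⟩ := h2
  have hc : Filter.Tendsto (fun s : ℝ => p + s • d) (nhdsWithin 0 (Set.Ioi 0)) (nhds p) := by
    have : Continuous fun s : ℝ => p + s • d := by fun_prop
    exact (by simpa using this.tendsto 0 : Filter.Tendsto (fun s : ℝ => p + s • d) (nhds 0)
      (nhds p)).mono_left nhdsWithin_le_nhds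
  refine ⟨w, ?_, ?_⟩
  · exact (T.tile w).isClosed_region.mem_of_frequently_of_tendsto hw hc
  · obtain ⟨s, hs, hs0⟩ := (hw.and_eventually self_mem_nhdsWithin).exists
    exact ConvexPolygon.tangentDir_of_mem hs0 hs

theorem not_innerDir_innerDir {w w' : W} (hw : w ≠ w') {p d : ℂ} (hp : p ∈ (T.tile w).region)
    (hp' : p ∈ (T.tile w').region) (hd : (T.tile w).InnerDir p d) :
    ¬ (T.tile w').InnerDir p d := fun hd' => by
  obtain ⟨s, hs, hs'⟩ := ((ConvexPolygon.eventually_mem_interior hp hd).and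
    (ConvexPolygon.eventually_mem_interior hp' hd')).exists
  exact Set.disjoint_left.1 (T.disjoint_interior w w' hw) hs hs'

theorem tangentDir_of_tile {w : W} {p d : ℂ} (hp : p ∈ (T.tile w).region)
    (hd : (T.tile w).TangentDir p d) : R.TangentDir p d := by
  obtain ⟨s, hs, hs0⟩ := ((ConvexPolygon.eventually_mem_region hp hd).and
    self_mem_nhdsWithin).exists
  exact ConvexPolygon.tangentDir_of_mem hs0 (T.tile_subset w hs)

theorem innerDir_of_tile {w : W} {p d : ℂ} (hp : p ∈ (T.tile w).region)
    (hd : (T.tile w).InnerDir p d) : R.InnerDir p d := by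
  obtain ⟨s, hs, hs0⟩ := ((ConvexPolygon.eventually_mem_interior hp hd).and
    self_mem_nhdsWithin).exists
  exact ConvexPolygon.innerDir_of_mem hs0 (interior_mono (T.tile_subset w) hs)

variable (T) in
/-- Near `p`, the half-plane to the left of `h` is tiled by tiles of `I`, and the tile boundaries
do not enter the opposite half-plane. -/
structure LocalHalfPlane (p h : ℂ) (I : Set W) : Prop where
  ne_zero : h ≠ 0
  cover : ∀ d, 0 < wedge h d → ∃ w ∈ I, p ∈ (T.tile w).region ∧ (T.tile w).TangentDir p d
  subset : ∀ w ∈ I, p ∈ (T.tile w).region → ∀ d, (T.tile w).InnerDir p d → 0 ≤ wedge h d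
  outside : ∀ d, wedge h d < 0 →
    ∀ᶠ s in nhdsWithin (0 : ℝ) (Set.Ioi 0), p + s • d ∉ T.skeleton
  inside : ∀ d, 0 < wedge h d →
    ∀ᶠ s in nhdsWithin (0 : ℝ) (Set.Ioi 0), p + s • d ∈ interior R.region
  corner : ∀ w, p ∈ (T.tile w).corners → w ∈ I

/-- At a point inside a side of `R`, the half-plane is that of `R` and all tiles are kept. Otherwise
the point is inside a side of some tile `w'`, which fills one half-plane; the opposite one is kept,
and `w'` is left out of `I`. -/
theorem exists_localHalfPlane [Finite W] (hnd : T.Nondegenerate) {p : ℂ} (hp : p ∈ T.faces) :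
    ∃ h I, T.LocalHalfPlane p h I := by
  obtain ⟨hp1, hpR⟩ := hp
  obtain ⟨w, hw⟩ := Set.mem_iUnion.1 hp1
  have hpw : p ∈ (T.tile w).region := by
    obtain ⟨j, rfl⟩ := hw
    exact (T.tile w).vertex_mem_region j
  have hpreg := T.tile_subset w hpw
  by_cases hR : ∃ k, p ∈ R.openSide k
  · obtain ⟨k, hk⟩ := hR
    refine ⟨R.edge k, Set.univ, R.edge_ne_zero k, fun d hd => ?_, fun w _ hw d hd => ?_,
      fun d hd => ?_, fun d hd => ?_, fun _ _ => Set.mem_univ _⟩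
    · obtain ⟨w, h⟩ := exists_tangentDir (T := T) hpreg
        ((ConvexPolygon.tangentDir_openSide hk).2 hd.le)
      exact ⟨w, Set.mem_univ _, h⟩
    · exact ((ConvexPolygon.innerDir_openSide hk).1 (innerDir_of_tile hw hd)).le
    · filter_upwards [self_mem_nhdsWithin] with s hs hmem
      have h1 := R.mem_region_iff.1 (T.skeleton_subset hmem) k
      rw [ConvexPolygon.height_add_smul, (R.height_eq_zero_of_mem_openSide hk).2 rfl] at h1
      have hs' : 0 < s := hs
      nlinarith
    · exact ConvexPolygon.eventually_mem_interior hpreg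
        ((ConvexPolygon.innerDir_openSide hk).2 hd)
  · obtain ⟨w', j, hj⟩ := (hnd.2 w p hw hpR).resolve_right hR
    have hpw' := (T.tile w').openSide_subset_region j hj
    have hint : ∀ k, R.height k p ≠ 0 := fun k hk =>
      hR ⟨k, ConvexPolygon.mem_openSide_of_height_eq_zero hpreg hpR hk⟩
    refine ⟨-(T.tile w').edge j, {w | w ≠ w'}, neg_ne_zero.2 ((T.tile w').edge_ne_zero j),
      fun d hd => ?_, fun w hw hpw d hd => ?_, fun d hd => ?_, fun d hd => ?_, fun w hw => ?_⟩
    · obtain ⟨w, h1, h2⟩ := exists_tangentDir (T := T) (d := d) hpreg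
        (fun k hk => absurd hk (hint k))
      refine ⟨w, ?_, h1, h2⟩
      rintro rfl
      rw [ConvexPolygon.tangentDir_openSide hj] at h2
      rw [wedge_neg_left] at hd
      linarith
    · by_contra hn
      rw [wedge_neg_left] at hn
      exact not_innerDir_innerDir hw hpw hpw' hd
        ((ConvexPolygon.innerDir_openSide hj).2 (by linarith))
    · rw [wedge_neg_left, neg_lt_zero, ← ConvexPolygon.innerDir_openSide hj] at hd
      exact (ConvexPolygon.eventually_mem_interior hpw' hd).mono fun s hs =>
        notMem_skeleton_of_mem_interior hs
    · exact ConvexPolygon.eventually_mem_interior hpreg fun k hk => absurd hk (hint k)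
    · rintro rfl
      exact ConvexPolygon.notMem_corners_of_mem_openSide hj hw

namespace LocalHalfPlane

variable {p h : ℂ} {I : Set W} (H : T.LocalHalfPlane p h I)

include H

/-- The outgoing edge is a limit of inner directions of the tile. -/
theorem wedge_edge_nonneg {w : W} {j} (hw : (T.tile w).vertex j = p) :
    0 ≤ wedge h ((T.tile w).edge j) := by
  subst hw
  refine nonneg_of_forall_add_mul (b := wedge h (-(T.tile w).edge ((T.tile w).prev j)))
    fun s hs => ?_
  have := H.subset w (H.corner w ⟨j, rfl⟩) ((T.tile w).vertex_mem_region j) _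
    (ConvexPolygon.innerDir_vertex_edge_sub j hs)
  rwa [wedge_add_right, wedge_smul_right] at this

theorem wedge_edge_prev_nonpos {w : W} {j} (hw : (T.tile w).vertex j = p) :
    wedge h ((T.tile w).edge ((T.tile w).prev j)) ≤ 0 := by
  subst hw
  rw [← neg_nonneg, ← wedge_neg_right]
  refine nonneg_of_forall_add_mul (b := wedge h ((T.tile w).edge j)) fun s hs => ?_
  have := H.subset w (H.corner w ⟨j, rfl⟩) ((T.tile w).vertex_mem_region j) _
    (ConvexPolygon.innerDir_vertex_sub_edge j hs)
  rwa [wedge_add_right, wedge_smul_right] at this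

/-- Without a corner at `p`, the tile `w` would have a side passing through `p`; it would fill the
whole half-plane and leave no room for the sector of `w₀`. -/
theorem mem_corners {w₀ : W} (hw₀ : p ∈ (T.tile w₀).corners) {w : W} (hw : w ∈ I)
    (hpw : p ∈ (T.tile w).region) : p ∈ (T.tile w).corners := by
  by_contra hc
  obtain ⟨j₀, hj₀⟩ := hw₀
  have hne : w ≠ w₀ := by
    rintro rfl; exact hc ⟨j₀, hj₀⟩
  have hI := wedge_I_mul_pos H.ne_zero
  have hact : ∃ j, (T.tile w).height j p = 0 := by
    by_contra! hn
    have := H.subset w hw hpw (-(Complex.I * h)) (fun j hj => absurd hj (hn j))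
    rw [wedge_neg_right] at this
    linarith
  obtain ⟨j, hj⟩ := hact
  have hopen := ConvexPolygon.mem_openSide_of_height_eq_zero hpw hc hj
  set e := (T.tile w).edge j with he
  have he0 : e ≠ 0 := (T.tile w).edge_ne_zero j
  have hIe := wedge_I_mul_pos he0
  have hsub : ∀ d, 0 < wedge e d → 0 ≤ wedge h d := fun d hd =>
    H.subset w hw hpw d ((ConvexPolygon.innerDir_openSide hopen).2 hd)
  have h1 : 0 ≤ wedge h e := nonneg_of_forall_add_mul (b := wedge h (Complex.I * e))
    fun s hs => by
      have := hsub (e + s • (Complex.I * e)) (by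
        rw [wedge_add_right, wedge_self, wedge_smul_right, zero_add]; positivity)
      rwa [wedge_add_right, wedge_smul_right] at this
  have h2 : 0 ≤ -wedge h e := nonneg_of_forall_add_mul (b := wedge h (Complex.I * e))
    fun s hs => by
      have := hsub (-e + s • (Complex.I * e)) (by
        rw [wedge_add_right, wedge_neg_right, wedge_self, wedge_smul_right, neg_zero, zero_add]
        positivity)
      rwa [wedge_add_right, wedge_smul_right, wedge_neg_right] at this
  have h3 : wedge e h = 0 := by rw [wedge_swap]; linarith
  obtain ⟨r, hr⟩ := exists_smul_of_wedge_eq_zero he0 h3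
  have hr0 : r ≠ 0 := by
    rintro rfl
    exact H.ne_zero (by rw [hr, zero_smul])
  have h4 := hsub _ hIe
  rw [hr, wedge_smul_left] at h4
  have hrpos : 0 < r := lt_of_le_of_ne (nonneg_of_mul_nonneg_left h4 hIe) hr0.symm
  have ha := H.wedge_edge_nonneg hj₀
  have hq := H.wedge_edge_prev_nonpos hj₀
  set a := (T.tile w₀).edge j₀
  set q := (T.tile w₀).edge ((T.tile w₀).prev j₀)
  have hqa : 0 < wedge q a := (T.tile w₀).wedge_edge_pos j₀
  rw [hr, wedge_smul_left] at ha hq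
  have ha' := nonneg_of_mul_nonneg_right ha hrpos
  have hq' : wedge e q ≤ 0 := by
    by_contra hn
    nlinarith
  have hpos : 0 < wedge e (a + (1 : ℝ) • -q) := by
    rw [wedge_add_right, one_smul, wedge_neg_right]
    by_contra hn
    have e1 : wedge e a = 0 := by linarith
    have e2 : wedge e q = 0 := by linarith
    obtain ⟨r1, h1⟩ := exists_smul_of_wedge_eq_zero he0 e1
    obtain ⟨r2, h2⟩ := exists_smul_of_wedge_eq_zero he0 e2
    rw [h1, h2, wedge_smul_left, wedge_smul_right, wedge_self] at hqa
    simp at hqa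
  refine not_innerDir_innerDir hne hpw (hj₀ ▸ (T.tile w₀).vertex_mem_region j₀)
    ((ConvexPolygon.innerDir_openSide hopen).2 hpos) ?_
  rw [← hj₀]
  exact ConvexPolygon.innerDir_vertex_edge_sub j₀ one_pos

end LocalHalfPlane

variable (T) in
/-- The corners of the tiles. -/
abbrev Slot : Type _ := Σ w, Fin (T.tile w).n

variable (T) in
/-- The location of a corner of a tile. -/
def pt (s : T.Slot) : ℂ := (T.tile s.1).vertex s.2

variable (T) in
/-- The edge vector that leaves a corner of a tile. -/
def outEdge (s : T.Slot) : ℂ := (T.tile s.1).edge s.2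

variable (T) in
/-- The edge vector that arrives at a corner of a tile. -/
def inEdge (s : T.Slot) : ℂ := (T.tile s.1).edge ((T.tile s.1).prev s.2)

theorem wedge_inEdge_outEdge (s : T.Slot) : 0 < wedge (T.inEdge s) (T.outEdge s) :=
  (T.tile s.1).wedge_edge_pos s.2

variable (T) in
/-- The maximal segment along which the side leaving a corner of a tile lies. -/
noncomputable def outBlack [Finite W] (s : T.Slot) : T.Black := T.black s.1 s.2

variable (T) in
/-- The maximal segment along which the side arriving at a corner of a tile lies. -/
noncomputable def inBlack [Finite W] (s : T.Slot) : T.Black :=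
  T.black s.1 ((T.tile s.1).prev s.2)

variable (T) in
/-- The corners `s` and `s'` of tiles are the two corners at the point `p`, one maximal segment
passes through `p`, and another one ends there. -/
structure IsTee [Finite W] (p : ℂ) (s s' : T.Slot) : Prop where
  ne : s.1 ≠ s'.1
  pt_left : T.pt s = p
  pt_right : T.pt s' = p
  eq_or_eq : ∀ r, T.pt r = p → r = s ∨ r = s'
  through : ∃ κ : ℝ, 0 < κ ∧ T.outEdge s = κ • T.inEdge s'
  ending : ∃ ν : ℝ, 0 < ν ∧ T.inEdge s = (-ν) • T.outEdge s'
  outBlack_left : T.outBlack s = T.inBlack s'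
  outBlack_right : T.outBlack s' = T.inBlack s
  ray : ∀ z ∈ (T.outBlack s').1, ∃ r : ℝ, 0 ≤ r ∧ z = p + r • T.outEdge s'
  not_isBoundary : ¬ T.IsBoundary (T.outBlack s')

theorem eq_of_pt_eq {s s' : T.Slot} (hw : s.1 = s'.1) (h : T.pt s = T.pt s') : s = s' := by
  obtain ⟨w, j⟩ := s
  obtain ⟨w', j'⟩ := s'
  obtain rfl : w = w' := hw
  rw [(T.tile w).vertex_injective (show (T.tile w).vertex j = (T.tile w).vertex j' from h)]

/-- At a bounded face that is a quadrilateral exactly two tiles have a corner. -/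
theorem exists_two_slots [Finite W] {p : ℂ} (hp : T.faceDegree p = 4) :
    ∃ s s' : T.Slot, s.1 ≠ s'.1 ∧ T.pt s = p ∧ T.pt s' = p ∧
      ∀ r, T.pt r = p → r = s ∨ r = s' := by
  let S := {s : T.Slot // T.pt s = p}
  -- Each tile corner at `p` accounts for exactly two edges of the face, one for each side there, so
  -- degree four means two corners.
  let g : S × Bool → W × T.Black := fun x =>
    (x.1.1.1, if x.2 then T.outBlack x.1.1 else T.inBlack x.1.1)
  have hg : Function.Injective g := by
    rintro ⟨⟨s, hs⟩, b⟩ ⟨⟨s', hs'⟩, b'⟩ h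
    obtain ⟨h1, h2⟩ := Prod.ext_iff.1 h
    obtain rfl := eq_of_pt_eq h1 (hs.trans hs'.symm)
    have hne : T.inBlack s ≠ T.outBlack s := T.black_prev_ne s.1 s.2
    cases b <;> cases b' <;> simp [g, hne, hne.symm] at h2 ⊢
  have hrange : Set.range g
      = {e : W × T.Black | p ∈ (T.tile e.1).corners ∧ p ∈ e.2.1 ∧ T.Adj e.1 e.2} := by
    ext ⟨w, b⟩
    constructor
    · rintro ⟨⟨⟨s, hs⟩, c⟩, h⟩
      obtain ⟨rfl, rfl⟩ := Prod.ext_iff.1 h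
      refine ⟨⟨s.2, hs⟩, ?_⟩
      cases c
      · exact ⟨hs ▸ T.vertex_mem_black_prev s.1 s.2, _, T.side_subset_black _ _⟩
      · exact ⟨hs ▸ T.vertex_mem_black s.1 s.2, _, T.side_subset_black _ _⟩
    · intro he
      have he : p ∈ (T.tile w).corners ∧ p ∈ b.1 ∧ T.Adj w b := he
      obtain ⟨⟨j, hj⟩, hpb, k, hk⟩ := he
      obtain rfl : T.black w k = b := black_eq hk
      -- The segment of side `k` passes through corner `j`, so side `k` is one of the two sides at
      -- that corner.
      have h0 : (T.tile w).height k ((T.tile w).vertex j) = 0 := by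
        obtain ⟨r, -, hr⟩ := T.exists_edge_eq_smul_dir w k
        change wedge ((T.tile w).edge k) _ = 0
        rw [hr, wedge_smul_left, T.wedge_dir_sub (T.vertex_mem_black w k) (hj ▸ hpb), mul_zero]
      rcases (T.tile w).height_vertex_eq_zero.1 h0 with rfl | rfl
      · exact ⟨(⟨⟨w, k⟩, hj⟩, true), rfl⟩
      · exact ⟨(⟨⟨w, j⟩, hj⟩, false), rfl⟩
  have hcard : Nat.card S = 2 := by
    have h4 : (Set.range g).ncard = 4 := by rw [hrange]; exact hp
    rw [← Set.image_univ, Set.ncard_image_of_injective _ hg, Set.ncard_univ, Nat.card_prod] at h4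
    simp at h4
    omega
  obtain ⟨⟨s, hs⟩, ⟨s', hs'⟩, hne, huniv⟩ := Nat.card_eq_two_iff.1 hcard
  refine ⟨s, s', fun h => hne (Subtype.ext (eq_of_pt_eq h (hs.trans hs'.symm))), hs, hs',
    fun r hr => ?_⟩
  have : (⟨r, hr⟩ : S) ∈ ({⟨s, hs⟩, ⟨s', hs'⟩} : Set S) := huniv ▸ Set.mem_univ _
  rcases this with h | h
  · exact Or.inl (congrArg Subtype.val h)
  · exact Or.inr (congrArg Subtype.val h)

/-- The segment leaving along `outEdge s'` stops at `p` since the tile boundaries do not enter the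
opposite half-plane near `p`; it is interior since it immediately enters the interior of `R`. -/
theorem LocalHalfPlane.isTee [Finite W] {p h : ℂ} {I : Set W} (H : T.LocalHalfPlane p h I)
    {s s' : T.Slot} (hne : s.1 ≠ s'.1) (hs : T.pt s = p) (hs' : T.pt s' = p)
    (hall : ∀ r, T.pt r = p → r = s ∨ r = s')
    (hκ : ∃ κ : ℝ, 0 < κ ∧ T.outEdge s = κ • T.inEdge s')
    (hν : ∃ ν : ℝ, 0 < ν ∧ T.inEdge s = (-ν) • T.outEdge s')
    (hpos : 0 < wedge h (T.outEdge s')) : T.IsTee p s s' := by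
  have hmem_out : p ∈ (T.tile s'.1).side s'.2 := hs' ▸ left_mem_segment ℝ _ _
  have hmem_in : ∀ r : T.Slot, T.pt r = p → p ∈ (T.tile r.1).side ((T.tile r.1).prev r.2) := by
    rintro r rfl
    rw [ConvexPolygon.side, ConvexPolygon.next_prev]
    exact right_mem_segment ℝ _ _
  have hb : p ∈ (T.outBlack s').1 := T.side_subset_black _ _ hmem_out
  refine ⟨hne, hs, hs', hall, hκ, hν, ?_, ?_, fun z hz => ?_, fun hbd => ?_⟩
  · obtain ⟨κ, -, h⟩ := hκ
    exact black_eq_black (hmem_in s' hs') (hs ▸ left_mem_segment ℝ _ _) h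
  · obtain ⟨ν, -, h⟩ := hν
    exact (black_eq_black hmem_out (hmem_in s hs) h).symm
  · obtain ⟨c, hc, hc'⟩ := T.exists_edge_eq_smul_dir s'.1 s'.2
    obtain ⟨r, hr⟩ := T.exists_sub_eq_smul_dir hb hz
    have hz' : z = p + (r / c) • T.outEdge s' := by
      change _ = p + (r / c) • (T.tile s'.1).edge s'.2
      rw [hc', smul_smul, div_mul_cancel₀ _ hc]
      exact (add_eq_of_eq_sub' hr.symm).symm
    refine ⟨r / c, ?_, hz'⟩
    by_contra hn
    have hneg : wedge h (z - p) < 0 := by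
      rw [hz', add_sub_cancel_left, wedge_smul_right]
      nlinarith
    obtain ⟨t, ht, ht0, ht1⟩ := ((H.outside _ hneg).and
      (Ioc_mem_nhdsGT (zero_lt_one' ℝ))).exists
    apply ht
    apply T.black_subset (T.outBlack s')
    have hconv : Convex ℝ (T.outBlack s').1 := by
      rw [T.black_eq_segment]; exact convex_segment _ _
    exact hconv.add_smul_sub_mem hb hz ⟨ht0.le, ht1⟩
  · obtain ⟨t, ht, ht0, ht1⟩ := ((H.inside _ hpos).and
      (Ioc_mem_nhdsGT (zero_lt_one' ℝ))).exists
    have hside : p + t • T.outEdge s' ∈ (T.outBlack s').1 := by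
      apply T.side_subset_black s'.1 s'.2
      rw [ConvexPolygon.side, segment_eq_image']
      exact ⟨t, ⟨ht0.le, ht1⟩, by rw [← hs']; rfl⟩
    exact (hbd hside).2 ht

theorem exists_isTee [Finite W] (hnd : T.Nondegenerate) (hquad : T.QuadFaces) {p : ℂ}
    (hp : p ∈ T.faces) : ∃ s s', T.IsTee p s s' := by
  obtain ⟨h, I, H⟩ := exists_localHalfPlane hnd hp
  obtain ⟨s, s', hne, hs, hs', hall⟩ := exists_two_slots (hquad p hp)
  have hcov : ∀ d, 0 < wedge h d → (0 ≤ wedge (T.inEdge s) d ∧ 0 ≤ wedge (T.outEdge s) d) ∨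
      (0 ≤ wedge (T.inEdge s') d ∧ 0 ≤ wedge (T.outEdge s') d) := by
    intro d hd
    obtain ⟨w, hw, hpw, ht⟩ := H.cover d hd
    obtain ⟨j, hj⟩ := H.mem_corners ⟨s.2, hs⟩ hw hpw
    rw [← hj, ConvexPolygon.tangentDir_vertex] at ht
    rcases hall ⟨w, j⟩ hj with rfl | rfl
    · exact Or.inl ht
    · exact Or.inr ht
  have hdisj : ∀ d, 0 < wedge (T.inEdge s) d → 0 < wedge (T.outEdge s) d →
      0 < wedge (T.inEdge s') d → 0 < wedge (T.outEdge s') d → False := by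
    intro d h1 h2 h3 h4
    have hd : (T.tile s.1).InnerDir p d :=
      hs ▸ ConvexPolygon.innerDir_vertex.2 ⟨h1, h2⟩
    have hd' : (T.tile s'.1).InnerDir p d :=
      hs' ▸ ConvexPolygon.innerDir_vertex.2 ⟨h3, h4⟩
    exact not_innerDir_innerDir hne (hs ▸ (T.tile s.1).vertex_mem_region s.2)
      (hs' ▸ (T.tile s'.1).vertex_mem_region s'.2) hd hd'
  have ha := H.wedge_edge_nonneg hs
  have ha' := H.wedge_edge_nonneg hs'
  have hq := H.wedge_edge_prev_nonpos hs
  have hq' := H.wedge_edge_prev_nonpos hs'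
  have hI := wedge_I_mul_pos H.ne_zero
  -- Testing directions just inside the half-plane next to `h` finds the corner whose outgoing side
  -- runs along `h`; it takes the role of `s`.
  have key := nonneg_or_nonneg_of_forall_add_mul (a := -wedge h (T.outEdge s))
    (a' := -wedge h (T.outEdge s')) (b := wedge (T.outEdge s) (Complex.I * h))
    (b' := wedge (T.outEdge s') (Complex.I * h)) (by
      intro t ht
      have hd := hcov (h + t • (Complex.I * h)) (by
        rw [wedge_add_right, wedge_self, wedge_smul_right, zero_add]; positivity)
      simp only [wedge_add_right, wedge_smul_right] at hd
      rw [wedge_swap h (T.outEdge s), wedge_swap h (T.outEdge s')] at hd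
      exact hd.imp (fun h => h.2) (fun h => h.2))
  rcases key with h0 | h0
  · obtain ⟨h1, h2, h3⟩ := sectors_of_cover H.ne_zero (wedge_inEdge_outEdge s)
      (wedge_inEdge_outEdge s') ha ha' hq hq' hcov hdisj (le_antisymm (neg_nonneg.1 h0) ha)
    exact ⟨s, s', H.isTee hne hs hs' hall h1 h2 h3⟩
  · obtain ⟨h1, h2, h3⟩ := sectors_of_cover H.ne_zero (wedge_inEdge_outEdge s')
      (wedge_inEdge_outEdge s) ha' ha hq' hq (fun d hd => (hcov d hd).symm)
      (fun d h1 h2 h3 h4 => hdisj d h3 h4 h1 h2) (le_antisymm (neg_nonneg.1 h0) ha')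
    exact ⟨s', s, H.isTee hne.symm hs' hs (fun r hr => (hall r hr).symm) h1 h2 h3⟩

variable (T) in
/-- The corner `s` of a tile is the only one at the corner `k` of `R`, and has the same sides. -/
structure IsCornerSlot [Finite W] (k : Fin R.n) (s : T.Slot) : Prop where
  pt_eq : T.pt s = R.vertex k
  eq_of_pt_eq : ∀ r, T.pt r = R.vertex k → r = s
  outEdge : ∃ r : ℝ, 0 < r ∧ T.outEdge s = r • R.edge k
  inEdge : ∃ r : ℝ, 0 < r ∧ T.inEdge s = r • R.edge (R.prev k)
  isBoundary_outBlack : T.IsBoundary (T.outBlack s)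
  isBoundary_inBlack : T.IsBoundary (T.inBlack s)

/-- Since only one tile meets the corner of `R`, the tile and `R` have the same tangent cone there.
This cone contains no line, so the point is a corner of the tile, and comparing extremal rays
matches the sides. -/
theorem exists_isCornerSlot [Finite W] (hnd : T.Nondegenerate) (k : Fin R.n) :
    ∃ s, T.IsCornerSlot k s := by
  obtain ⟨w, hw, huniq⟩ := hnd.1 (R.vertex k) ⟨k, rfl⟩
  have hw : R.vertex k ∈ (T.tile w).region := hw
  have hRw : ∀ d, R.TangentDir (R.vertex k) d → (T.tile w).TangentDir (R.vertex k) d := by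
    intro d hd
    obtain ⟨w', h1, h2⟩ := exists_tangentDir (T := T) (R.vertex_mem_region k) hd
    rwa [huniq w' h1] at h2
  have hwR : ∀ d, (T.tile w).TangentDir (R.vertex k) d → R.TangentDir (R.vertex k) d :=
    fun d hd => tangentDir_of_tile hw hd
  have hQA := R.wedge_edge_pos k
  have hzero : ∀ d, (T.tile w).TangentDir (R.vertex k) d →
      (T.tile w).TangentDir (R.vertex k) (-d) → d = 0 := by
    intro d h1 h2
    have h1 := ConvexPolygon.tangentDir_vertex.1 (hwR d h1)
    have h2 := ConvexPolygon.tangentDir_vertex.1 (hwR (-d) h2)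
    rw [wedge_neg_right, wedge_neg_right] at h2
    refine eq_of_wedge_eq hQA.ne' ?_ ?_
    · rw [wedge_zero_right]; linarith
    · rw [wedge_zero_right]; linarith
  have hcorner : R.vertex k ∈ (T.tile w).corners := by
    by_contra hc
    by_cases hact : ∃ j, (T.tile w).height j (R.vertex k) = 0
    · obtain ⟨j, hj⟩ := hact
      have hopen := ConvexPolygon.mem_openSide_of_height_eq_zero hw hc hj
      refine (T.tile w).edge_ne_zero j (hzero _ ?_ ?_)
      · rw [ConvexPolygon.tangentDir_openSide hopen, wedge_self]
      · rw [ConvexPolygon.tangentDir_openSide hopen, wedge_neg_right, wedge_self, neg_zero]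
    · refine one_ne_zero (α := ℂ) (hzero 1 ?_ ?_)
      · exact fun j hj => absurd ⟨j, hj⟩ hact
      · exact fun j hj => absurd ⟨j, hj⟩ hact
  obtain ⟨j, hj⟩ := hcorner
  have hqa := (T.tile w).wedge_edge_pos j
  rw [← hj] at hRw
  have hwR' : ∀ d, (T.tile w).TangentDir ((T.tile w).vertex j) d → R.TangentDir (R.vertex k) d :=
    fun d hd => hwR d (hj ▸ hd)
  simp only [hj] at hRw
  have hwR2 : ∀ d, 0 ≤ wedge ((T.tile w).edge ((T.tile w).prev j)) d →
      0 ≤ wedge ((T.tile w).edge j) d →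
      0 ≤ wedge (R.edge (R.prev k)) d ∧ 0 ≤ wedge (R.edge k) d := fun d h1 h2 =>
    ConvexPolygon.tangentDir_vertex.1 (hwR' d (ConvexPolygon.tangentDir_vertex.2 ⟨h1, h2⟩))
  have hRw2 : ∀ d, 0 ≤ wedge (R.edge (R.prev k)) d → 0 ≤ wedge (R.edge k) d →
      0 ≤ wedge ((T.tile w).edge ((T.tile w).prev j)) d ∧ 0 ≤ wedge ((T.tile w).edge j) d := by
    intro d h1 h2
    have := hRw d (ConvexPolygon.tangentDir_vertex.2 ⟨h1, h2⟩)
    rw [← hj] at this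
    exact ConvexPolygon.tangentDir_vertex.1 this
  set q := (T.tile w).edge ((T.tile w).prev j)
  set a := (T.tile w).edge j
  set Q := R.edge (R.prev k)
  set A := R.edge k
  have hA : A ≠ 0 := R.edge_ne_zero k
  have hQ : Q ≠ 0 := R.edge_ne_zero _
  -- The two extremal rays of each cone are tested in the other cone.
  have e1 := hwR2 a hqa.le (by rw [wedge_self])
  have e2 := (hRw2 A hQA.le (by rw [wedge_self])).2
  have e3 := hwR2 (-q) (by rw [wedge_neg_right, wedge_self, neg_zero])
    (by rw [wedge_neg_right, ← wedge_swap]; exact hqa.le)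
  have e4 := (hRw2 (-Q) (by rw [wedge_neg_right, wedge_self, neg_zero])
    (by rw [wedge_neg_right, ← wedge_swap]; exact hQA.le)).1
  rw [wedge_swap] at e2
  rw [wedge_neg_right, ← wedge_swap] at e4
  rw [wedge_neg_right, wedge_neg_right, ← wedge_swap] at e3
  have hout : ∃ r : ℝ, 0 < r ∧ a = r • A := by
    obtain ⟨r, hr⟩ := exists_smul_of_wedge_eq_zero hA (show wedge A a = 0 by linarith [e1.2])
    refine ⟨r, ?_, hr⟩
    rw [hr, wedge_smul_right] at hqa e1
    have h0 : r ≠ 0 := by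
      rintro rfl
      simp at hqa
    exact lt_of_le_of_ne (nonneg_of_mul_nonneg_left e1.1 hQA) h0.symm
  have hin : ∃ r : ℝ, 0 < r ∧ q = r • Q := by
    have : wedge Q q = 0 := by
      rw [wedge_swap]
      have := e3.1
      rw [wedge_swap] at e4
      linarith
    obtain ⟨r, hr⟩ := exists_smul_of_wedge_eq_zero hQ this
    refine ⟨r, ?_, hr⟩
    have h3 := e3.2
    rw [hr, wedge_smul_right, wedge_swap Q A] at h3
    rw [hr, wedge_smul_left] at hqa
    have h0 : r ≠ 0 := by
      rintro rfl
      simp at hqa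
    exact lt_of_le_of_ne (nonneg_of_mul_nonneg_left (by linarith) hQA) h0.symm
  refine ⟨⟨w, j⟩, hj, fun r hr => ?_, hout, hin, ?_, ?_⟩
  · refine eq_of_pt_eq ?_ (hr.trans hj.symm)
    exact huniq r.1 (show R.vertex k ∈ _ from hr ▸ (T.tile r.1).vertex_mem_region r.2)
  · obtain ⟨r, hr0, hr⟩ := hout
    obtain ⟨c, hc0, hc⟩ := T.exists_edge_eq_smul_dir w j
    refine isBoundary_of_parallel (k := k) (hj ▸ T.vertex_mem_black w j)
      (left_mem_segment ℝ _ _) ?_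
    have h0 : wedge A a = 0 := by rw [hr, wedge_smul_right, wedge_self, mul_zero]
    change a = _ at hc
    rw [hc, wedge_smul_right] at h0
    exact (mul_eq_zero.1 h0).resolve_left hc0
  · obtain ⟨r, hr0, hr⟩ := hin
    obtain ⟨c, hc0, hc⟩ := T.exists_edge_eq_smul_dir w ((T.tile w).prev j)
    refine isBoundary_of_parallel (k := R.prev k) (hj ▸ T.vertex_mem_black_prev w j) ?_ ?_
    · rw [ConvexPolygon.side, ConvexPolygon.next_prev]
      exact right_mem_segment ℝ _ _
    · have h0 : wedge Q q = 0 := by rw [hr, wedge_smul_right, wedge_self, mul_zero]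
      change q = _ at hc
      rw [hc, wedge_smul_right] at h0
      exact (mul_eq_zero.1 h0).resolve_left hc0

end ConvexTiling

/-! ### Intercepts as coordinates on homology tilings -/

namespace ConvexTiling

variable {R : ConvexPolygon} {W : Type*} (T : ConvexTiling R W)

/-- The intercepts of the segments that are not on the boundary of `R`, relative to `T`. -/
abbrev Offset : Type := {b : T.Black // ¬ T.IsBoundary b} → ℝ

open Classical in
/-- The intercept of a maximal segment, which vanishes for boundary segments. -/
noncomputable def intercept (b : T.Black) : T.Offset →ₗ[ℝ] ℝ :=
  if h : T.IsBoundary b then 0 else LinearMap.proj ⟨b, h⟩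

theorem intercept_of_isBoundary {b : T.Black} (h : T.IsBoundary b) : T.intercept b = 0 :=
  dif_pos h

theorem intercept_apply (b : {b : T.Black // ¬ T.IsBoundary b}) (x : T.Offset) :
    T.intercept b.1 x = x b := by
  rw [intercept, dif_neg b.2]; rfl

/-- The line parallel to a maximal segment with a given intercept. -/
noncomputable def offsetLine (b : T.Black) (c : ℝ) : AffineSubspace ℝ ℂ :=
  AffineSubspace.mk' (T.base b + (c / wedge (T.dir b) (Complex.I * T.dir b)) •
    (Complex.I * T.dir b)) (Submodule.span ℝ {T.dir b})

variable {T}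

theorem mem_span_dir {b : T.Black} {z : ℂ} :
    z ∈ Submodule.span ℝ {T.dir b} ↔ wedge (T.dir b) z = 0 := by
  rw [Submodule.mem_span_singleton]
  constructor
  · rintro ⟨r, rfl⟩
    rw [wedge_smul_right, wedge_self, mul_zero]
  · intro h
    obtain ⟨r, hr⟩ := exists_smul_of_wedge_eq_zero (T.dir_ne_zero b) h
    exact ⟨r, hr.symm⟩

theorem mem_offsetLine {b : T.Black} {c : ℝ} {z : ℂ} :
    z ∈ T.offsetLine b c ↔ wedge (T.dir b) (z - T.base b) = c := by
  have h := wedge_I_mul_pos (T.dir_ne_zero b)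
  rw [offsetLine, AffineSubspace.mem_mk', mem_span_dir, vsub_eq_sub, ← sub_sub, wedge_sub_right,
    wedge_smul_right, div_mul_cancel₀ _ h.ne', sub_eq_zero]

theorem offsetLine_direction (b : T.Black) (c : ℝ) :
    (T.offsetLine b c).direction = Submodule.span ℝ {T.dir b} :=
  AffineSubspace.direction_mk' _ _

theorem affineSpan_black (b : T.Black) : affineSpan ℝ b.1 = T.offsetLine b 0 := by
  refine le_antisymm (affineSpan_le.2 fun z hz => ?_) fun z hz => ?_
  · exact mem_offsetLine.2 (T.wedge_dir_sub (T.base_mem b) hz)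
  · rw [mem_offsetLine] at hz
    obtain ⟨r, hr⟩ := exists_smul_of_wedge_eq_zero (T.dir_ne_zero b) hz
    have h1 := AffineMap.lineMap_mem (k := ℝ) r (subset_affineSpan ℝ b.1 (T.base_mem b))
      (subset_affineSpan ℝ b.1 (T.base_add_dir_mem b))
    have e : AffineMap.lineMap (T.base b) (T.base b + T.dir b) r = z := by
      rw [AffineMap.lineMap_apply, vsub_eq_sub, add_sub_cancel_left, ← hr]
      simp
    rwa [e] at h1

theorem offsetLine_nonempty (b : T.Black) (c : ℝ) : (T.offsetLine b c : Set ℂ).Nonempty :=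
  ⟨_, AffineSubspace.self_mem_mk' _ _⟩

theorem offsetLine_parallel (b : T.Black) (c : ℝ) :
    (T.offsetLine b c).Parallel (affineSpan ℝ b.1) := by
  rw [affineSpan_black, AffineSubspace.parallel_iff_direction_eq_and_eq_bot_iff_eq_bot,
    offsetLine_direction, offsetLine_direction]
  refine ⟨rfl, ?_⟩
  have h1 := (AffineSubspace.nonempty_iff_ne_bot _).1 (offsetLine_nonempty b c)
  have h2 := (AffineSubspace.nonempty_iff_ne_bot _).1 (offsetLine_nonempty b 0)
  exact iff_of_false h1 h2

theorem exists_eq_offsetLine {b : T.Black} {L : AffineSubspace ℝ ℂ}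
    (h : L.Parallel (affineSpan ℝ b.1)) : ∃ c, L = T.offsetLine b c := by
  rw [affineSpan_black, AffineSubspace.parallel_iff_direction_eq_and_eq_bot_iff_eq_bot] at h
  have h2 := (AffineSubspace.nonempty_iff_ne_bot _).1 (offsetLine_nonempty b 0)
  obtain ⟨z, hz⟩ := (AffineSubspace.nonempty_iff_ne_bot L).2 fun hb => h2 (h.2.1 hb)
  refine ⟨wedge (T.dir b) (z - T.base b), AffineSubspace.ext_of_direction_eq ?_
    ⟨z, hz, mem_offsetLine.2 rfl⟩⟩
  rw [h.1, offsetLine_direction, offsetLine_direction]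

/-- The corner `s` is the lowest corner of its tile with respect to `tilt t`. -/
def IsLowest (t : ℝ) (s : T.Slot) : Prop :=
  ∀ k, tilt t (T.pt s) ≤ tilt t ((T.tile s.1).vertex k)

theorem IsLowest.tilt_pos {t : ℝ} (ht : ∀ s : T.Slot, tilt t (T.outEdge s) ≠ 0) {s : T.Slot}
    (hs : IsLowest t s) : tilt t (T.inEdge s) < 0 ∧ 0 < tilt t (T.outEdge s) := by
  constructor
  · refine lt_of_le_of_ne ?_ (ht ⟨s.1, (T.tile s.1).prev s.2⟩)
    rw [inEdge, ConvexPolygon.edge_prev, map_sub, sub_nonpos]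
    exact hs _
  · refine lt_of_le_of_ne ?_ (ht s).symm
    rw [outEdge, ConvexPolygon.edge, map_sub, sub_nonneg]
    exact hs _

theorem exists_isLowest (t : ℝ) (w : W) : ∃ j, IsLowest t (⟨w, j⟩ : T.Slot) :=
  Finite.exists_min fun j => tilt t ((T.tile w).vertex j)

variable (T) [Finite W]

/-- The displacement of the corners of a tile when the maximal segments are moved. -/
noncomputable def disp (w : W) : T.Offset →ₗ[ℝ] (Fin (T.tile w).n → ℂ) :=
  LinearMap.pi fun j =>
    (wedge (T.dir (T.black w j)) (T.dir (T.black w ((T.tile w).prev j))))⁻¹ •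
      ((T.intercept (T.black w j)).smulRight (T.dir (T.black w ((T.tile w).prev j))) -
        (T.intercept (T.black w ((T.tile w).prev j))).smulRight (T.dir (T.black w j)))

theorem disp_apply (w : W) (x : T.Offset) (j) : T.disp w x j =
    (wedge (T.dir (T.black w j)) (T.dir (T.black w ((T.tile w).prev j))))⁻¹ •
      (T.intercept (T.black w j) x • T.dir (T.black w ((T.tile w).prev j)) -
        T.intercept (T.black w ((T.tile w).prev j)) x • T.dir (T.black w j)) := rfl

theorem wedge_dir_disp (w : W) (x : T.Offset) (j) :
    wedge (T.dir (T.black w j)) (T.disp w x j) = T.intercept (T.black w j) x := by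
  have h : wedge (T.dir (T.black w j)) (T.dir (T.black w ((T.tile w).prev j))) ≠ 0 := by
    rw [wedge_swap]; exact neg_ne_zero.2 (T.wedge_dir_ne_zero w j)
  rw [disp_apply, wedge_smul_right, wedge_sub_right, wedge_smul_right, wedge_smul_right, wedge_self]
  field_simp
  ring

theorem wedge_dir_prev_disp (w : W) (x : T.Offset) (j) :
    wedge (T.dir (T.black w ((T.tile w).prev j))) (T.disp w x j)
      = T.intercept (T.black w ((T.tile w).prev j)) x := by
  have h := T.wedge_dir_ne_zero w j
  rw [disp_apply, wedge_smul_right, wedge_sub_right, wedge_smul_right, wedge_smul_right, wedge_self,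
    wedge_swap (T.dir (T.black w ((T.tile w).prev j)))]
  field_simp
  ring

theorem wedge_dir_disp_next (w : W) (x : T.Offset) (j) :
    wedge (T.dir (T.black w j)) (T.disp w x (finRotate _ j)) = T.intercept (T.black w j) x := by
  have := T.wedge_dir_prev_disp w x (finRotate _ j)
  rwa [ConvexPolygon.prev_next] at this

variable {T}

theorem eq_disp {w : W} {x : T.Offset} {j} {z : ℂ}
    (h1 : wedge (T.dir (T.black w ((T.tile w).prev j))) z
      = T.intercept (T.black w ((T.tile w).prev j)) x)
    (h2 : wedge (T.dir (T.black w j)) z = T.intercept (T.black w j) x) : z = T.disp w x j :=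
  eq_of_wedge_eq (T.wedge_dir_ne_zero w j) (h1.trans (T.wedge_dir_prev_disp w x j).symm)
    (h2.trans (T.wedge_dir_disp w x j).symm)

theorem disp_mem_homologyTiles (w : W) (x : T.Offset) :
    T.disp w x ∈ (T.tile w).homologyTiles := fun j => by
  refine exists_smul_of_wedge_eq_zero ((T.tile w).edge_ne_zero j) ?_
  obtain ⟨r, -, hr⟩ := T.exists_edge_eq_smul_dir w j
  change wedge ((T.tile w).edge j) _ = 0
  rw [hr, wedge_smul_left, wedge_sub_right, wedge_dir_disp, wedge_dir_disp_next, sub_self, mul_zero]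

/-- Both corners are the intersection of the same two lines, the one passing through and the one
ending, so they move together. -/
theorem IsTee.disp_eq {p : ℂ} {s s' : T.Slot} (H : T.IsTee p s s') (x : T.Offset) :
    T.disp s.1 x s.2 = T.disp s'.1 x s'.2 := by
  have h1 : T.black s.1 s.2 = T.black s'.1 ((T.tile s'.1).prev s'.2) := H.outBlack_left
  have h2 : T.black s'.1 s'.2 = T.black s.1 ((T.tile s.1).prev s.2) := H.outBlack_right
  refine eq_disp ?_ ?_
  · rw [← h1, wedge_dir_disp]
  · rw [h2, wedge_dir_prev_disp]

theorem IsCornerSlot.disp_eq_zero {k : Fin R.n} {s : T.Slot} (H : T.IsCornerSlot k s)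
    (x : T.Offset) : T.disp s.1 x s.2 = 0 := by
  have h1 : T.intercept (T.black s.1 s.2) = 0 := T.intercept_of_isBoundary H.isBoundary_outBlack
  have h2 : T.intercept (T.black s.1 ((T.tile s.1).prev s.2)) = 0 :=
    T.intercept_of_isBoundary H.isBoundary_inBlack
  rw [disp_apply, h1, h2]
  simp

variable (T) in
/-- The homology tiling with given intercepts. -/
noncomputable def homologyTilingOf (x : T.Offset) : T.HomologyTiling where
  line b := T.offsetLine b (T.intercept b x)
  line_parallel b := offsetLine_parallel b _
  line_boundary b hb := by
    rw [T.intercept_of_isBoundary hb, affineSpan_black]; rfl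
  path w := (T.tile w).vertex + T.disp w x
  path_mem w j b hb := by
    obtain rfl := black_eq hb
    simp only [mem_offsetLine, Pi.add_apply, add_sub_right_comm, wedge_add_right]
    rw [wedge_dir_disp, wedge_dir_disp_next,
      T.wedge_dir_sub (T.base_mem _) (T.vertex_mem_black w j),
      T.wedge_dir_sub (T.base_mem _) (T.vertex_next_mem_black w j)]
    simp

/-- The line of each segment is given by its intercept, zero on the boundary, and each corner is
determined by two transverse lines. Hence intercepts parametrize all homology tilings. -/
theorem exists_eq_homologyTilingOf (H : T.HomologyTiling) : ∃ x, H = T.homologyTilingOf x := by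
  choose c hc using fun b => exists_eq_offsetLine (H.line_parallel b)
  obtain ⟨x, hx⟩ : ∃ x : T.Offset, ∀ b, T.intercept b x = c b := by
    refine ⟨fun b => c b.1, fun b => ?_⟩
    by_cases hb : T.IsBoundary b
    · have h1 := H.line_boundary b hb
      have h2 := subset_affineSpan ℝ b.1 (T.base_mem b)
      rw [T.intercept_of_isBoundary hb]
      rw [← h1, hc, SetLike.mem_coe, mem_offsetLine, sub_self, wedge_zero_right] at h2
      exact h2
    · exact T.intercept_apply ⟨b, hb⟩ _
  refine ⟨x, ?_⟩
  have h1 : H.line = (T.homologyTilingOf x).line := funext fun b => by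
    rw [hc, ← hx]; rfl
  have h2 : H.path = (T.homologyTilingOf x).path := by
    funext w j
    have e1 := (H.path_mem w j _ (T.side_subset_black w j)).1
    have e2 := (H.path_mem w ((T.tile w).prev j) _ (T.side_subset_black w _)).2
    rw [ConvexPolygon.next_prev] at e2
    rw [hc, mem_offsetLine, ← hx] at e1 e2
    have e : H.path w j - (T.tile w).vertex j = T.disp w x j := by
      refine eq_disp ?_ ?_
      · rw [← e2, ← sub_sub_sub_cancel_right _ _ (T.base _), wedge_sub_right,
          T.wedge_dir_sub (T.base_mem _) (T.vertex_mem_black_prev w j), sub_zero]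
      · rw [← e1, ← sub_sub_sub_cancel_right _ _ (T.base _), wedge_sub_right,
          T.wedge_dir_sub (T.base_mem _) (T.vertex_mem_black w j), sub_zero]
    change _ = (T.tile w).vertex j + T.disp w x j
    rw [← e]; ring
  obtain ⟨line, _, _, path, _⟩ := H
  simp only at h1 h2
  subst h1 h2
  rfl

theorem exists_isCornerSlot_or_exists_isTee (hnd : T.Nondegenerate) (hquad : T.QuadFaces)
    (s : T.Slot) : (∃ k, T.IsCornerSlot k s) ∨
      ∃ r r', T.IsTee (T.pt s) r r' ∧ (s = r ∨ s = r') := by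
  by_cases h : T.pt s ∈ R.corners
  · obtain ⟨k, hk⟩ := h
    obtain ⟨r, hr⟩ := exists_isCornerSlot hnd k
    obtain rfl := hr.eq_of_pt_eq s hk.symm
    exact Or.inl ⟨k, hr⟩
  · obtain ⟨r, r', hr⟩ := exists_isTee hnd hquad (p := T.pt s)
      ⟨Set.mem_iUnion.2 ⟨s.1, s.2, rfl⟩, h⟩
    exact Or.inr ⟨r, r', hr, hr.eq_or_eq s rfl⟩

/-! ### Conservation of area, rigidity and counting -/

/-- Sums over the corners of the tiles localize at the corners of `R` when the two corners at each
`T` cancel. -/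
theorem sum_slot [Fintype W] (hnd : T.Nondegenerate) (hquad : T.QuadFaces) {F : T.Slot → ℝ}
    (hF : ∀ p s s', T.IsTee p s s' → F s + F s' = 0) {c : Fin R.n → T.Slot}
    (hc : ∀ k, T.IsCornerSlot k (c k)) : ∑ s, F s = ∑ k, F (c k) := by
  classical
  rw [← Finset.sum_fiberwise_of_maps_to (t := Finset.univ.image T.pt)
    (fun s _ => Finset.mem_image_of_mem _ (Finset.mem_univ s))]
  have hsub : Finset.univ.image R.vertex ⊆ Finset.univ.image T.pt := by
    intro p hp
    obtain ⟨k, -, rfl⟩ := Finset.mem_image.1 hp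
    rw [← (hc k).pt_eq]
    exact Finset.mem_image_of_mem _ (Finset.mem_univ _)
  rw [← Finset.sum_subset hsub, Finset.sum_image fun k _ k' _ h => R.vertex_injective h]
  · refine Finset.sum_congr rfl fun k _ => ?_
    have : Finset.univ.filter (fun s => T.pt s = R.vertex k) = {c k} := by
      ext s
      simp only [Finset.mem_filter, Finset.mem_univ, true_and, Finset.mem_singleton]
      exact ⟨(hc k).eq_of_pt_eq s, fun h => h ▸ (hc k).pt_eq⟩
    rw [this, Finset.sum_singleton]
  · intro p hp hpR
    obtain ⟨s₀, -, rfl⟩ := Finset.mem_image.1 hp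
    rcases exists_isCornerSlot_or_exists_isTee hnd hquad s₀ with ⟨k, hk⟩ | ⟨s, s', H, -⟩
    · exact absurd (hk.pt_eq ▸ Finset.mem_image_of_mem _ (Finset.mem_univ k)) hpR
    · have : Finset.univ.filter (fun s => T.pt s = T.pt s₀) = {s, s'} := by
        ext r
        simp only [Finset.mem_filter, Finset.mem_univ, true_and, Finset.mem_insert,
          Finset.mem_singleton]
        refine ⟨H.eq_or_eq r, ?_⟩
        rintro (rfl | rfl)
        exacts [H.pt_left, H.pt_right]
      rw [this, Finset.sum_pair fun h => H.ne (congrArg Sigma.fst h), hF _ _ _ H]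

theorem exists_tilt_outEdge_ne_zero (T : ConvexTiling R W) :
    ∃ t, ∀ s : T.Slot, tilt t (T.outEdge s) ≠ 0 :=
  exists_tilt_ne_zero _ fun s => (T.tile s.1).edge_ne_zero s.2

/-- The total area does not depend on the intercepts. -/
theorem sum_pathArea [Fintype W] (hnd : T.Nondegenerate) (hquad : T.QuadFaces) (x : T.Offset) :
    ∑ w, pathArea ((T.tile w).vertex + T.disp w x) = R.area := by
  obtain ⟨t, ht⟩ := exists_tilt_outEdge_ne_zero T
  choose c hc using exists_isCornerSlot hnd
  have htR : ∀ k, tilt t (R.edge k) ≠ 0 := by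
    intro k h
    obtain ⟨r, -, hr⟩ := (hc k).outEdge
    apply ht (c k)
    rw [hr, map_smul, h, smul_zero]
  let F : T.Slot → ℝ := fun s => (slopeAt t (T.outEdge s) - slopeAt t (T.inEdge s)) / 2 *
    tilt t (T.pt s + T.disp s.1 x s.2) ^ 2
  have e1 : ∀ w, pathArea ((T.tile w).vertex + T.disp w x) = ∑ j, F ⟨w, j⟩ := fun w =>
    ConvexPolygon.pathArea_eq_sum_slopeAt (fun j => ht ⟨w, j⟩)
      (ConvexPolygon.add_mem_homologyTiles (T.tile w).vertex_mem_homologyTiles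
        (disp_mem_homologyTiles w x))
  -- At a `T` the outgoing side of each tile is parallel to the incoming side of the other, so the
  -- coefficients are opposite, while the displaced heights agree.
  have hF : ∀ p s s', T.IsTee p s s' → F s + F s' = 0 := by
    intro p s s' H
    obtain ⟨κ, hκ, h1⟩ := H.through
    obtain ⟨ν, hν, h2⟩ := H.ending
    simp only [F]
    rw [h1, h2, slopeAt_smul _ hκ.ne', slopeAt_smul _ (neg_ne_zero.2 hν.ne'), H.pt_left,
      H.pt_right, H.disp_eq]
    ring
  simp only [e1]
  rw [← Fintype.sum_sigma' (f := fun w j => F ⟨w, j⟩)]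
  change ∑ s, F s = _
  rw [sum_slot hnd hquad hF hc, ConvexPolygon.area,
    ConvexPolygon.pathArea_eq_sum_slopeAt htR R.vertex_mem_homologyTiles]
  refine Finset.sum_congr rfl fun k _ => ?_
  obtain ⟨r, hr, h1⟩ := (hc k).outEdge
  obtain ⟨r', hr', h2⟩ := (hc k).inEdge
  simp only [F]
  rw [h1, h2, slopeAt_smul _ hr.ne', slopeAt_smul _ hr'.ne', (hc k).pt_eq, (hc k).disp_eq_zero,
    add_zero]

/-- The total area is a constant quadratic polynomial; its second difference at `-x`, `0`, `x`
isolates the quadratic part. -/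
theorem sum_pathArea_disp [Fintype W] (hnd : T.Nondegenerate) (hquad : T.QuadFaces)
    (x : T.Offset) : ∑ w, pathArea (T.disp w x) = 0 := by
  have h0 := sum_pathArea hnd hquad (0 : T.Offset)
  have h1 := sum_pathArea hnd hquad x
  have h2 := sum_pathArea hnd hquad ((-1 : ℝ) • x)
  simp only [map_smul, map_zero, add_zero, pathArea_add, pathArea_smul, Finset.sum_add_distrib,
    smul_eq_mul, neg_one_sq, one_mul, ← Finset.mul_sum] at h0 h1 h2
  linarith

theorem sum_areaForm_disp [Fintype W] (hnd : T.Nondegenerate) (hquad : T.QuadFaces)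
    (x v : T.Offset) :
    ∑ w, areaForm _ ((T.tile w).vertex + T.disp w x) (T.disp w v) = 0 := by
  have h1 := sum_pathArea hnd hquad x
  have h2 := sum_pathArea hnd hquad (x + v)
  have h3 := sum_pathArea_disp hnd hquad v
  simp only [map_add, ← add_assoc] at h2
  simp only [pathArea_add (_ + _), Finset.sum_add_distrib, ← Finset.mul_sum] at h2
  linarith

/-- Along the segment passing through, one tile leaves `p` in the direction in which the other
arrives; lowest corners would require opposite signs of the height there. -/
theorem IsTee.not_isLowest {t : ℝ} (ht : ∀ s : T.Slot, tilt t (T.outEdge s) ≠ 0) {p : ℂ}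
    {s s' : T.Slot} (H : T.IsTee p s s') (hs : IsLowest t s) : ¬ IsLowest t s' := fun hs' => by
  obtain ⟨κ, hκ, h1⟩ := H.through
  have h2 := (hs.tilt_pos ht).2
  have h3 := (hs'.tilt_pos ht).1
  rw [h1, map_smul, smul_eq_mul] at h2
  nlinarith

/-- If all tiles are translated, then nothing moves. -/
theorem eq_zero_of_disp_const (hnd : T.Nondegenerate) (hquad : T.QuadFaces) {x : T.Offset}
    (hx : ∀ w j k, T.disp w x j = T.disp w x k) : x = 0 := by
  obtain ⟨t, ht⟩ := exists_tilt_outEdge_ne_zero T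
  choose lo hlo using exists_isLowest (T := T) t
  have hall : ∀ w, ∀ j, T.disp w x j = 0 := by
    by_contra! hc
    have : Nonempty {w // ∃ j, T.disp w x j ≠ 0} := ⟨⟨_, hc.choose_spec⟩⟩
    -- Among the tiles that move, take one whose lowest corner is lowest. The other tile at that
    -- point moves as well and extends further down.
    obtain ⟨⟨w, j, hj⟩, hmin⟩ := Finite.exists_min
      fun w : {w // ∃ j, T.disp w x j ≠ 0} => tilt t (T.pt ⟨w.1, lo w.1⟩)
    have hne : T.disp w x (lo w) ≠ 0 := fun h => hj ((hx w j (lo w)).trans h)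
    have key : ∀ r : T.Slot, T.pt r = T.pt ⟨w, lo w⟩ → T.disp r.1 x r.2 = T.disp w x (lo w) →
        ¬ IsLowest t r → False := by
      intro r hr hd hl
      have h1 := hmin ⟨r.1, r.2, hd ▸ hne⟩
      refine hl fun k => ?_
      rw [hr]
      exact h1.trans (hlo r.1 k)
    rcases exists_isCornerSlot_or_exists_isTee hnd hquad ⟨w, lo w⟩ with
      ⟨k, hk⟩ | ⟨s, s', H, h | h⟩
    · exact hne (hk.disp_eq_zero x)
    · refine key s' H.pt_right ?_ (H.not_isLowest ht (h ▸ hlo w))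
      rw [← H.disp_eq, ← h]
    · refine key s H.pt_left ?_ fun hs => H.not_isLowest ht hs (h ▸ hlo w)
      rw [H.disp_eq, ← h]
  funext b
  obtain ⟨w, j, h⟩ := T.exists_side_subset b.1
  rw [← T.intercept_apply b x, ← h, ← wedge_dir_disp, hall, wedge_zero_right]; rfl

/-- There are at most as many tiles as interior segments, plus one. -/
theorem card_le [Fintype W] [Fintype {b : T.Black // ¬ T.IsBoundary b}] (hnd : T.Nondegenerate)
    (hquad : T.QuadFaces) :
    Fintype.card W ≤ Fintype.card {b : T.Black // ¬ T.IsBoundary b} + 1 := by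
  obtain ⟨t, ht⟩ := exists_tilt_outEdge_ne_zero T
  choose lo hlo using exists_isLowest (T := T) t
  -- A tile is sent to the interior segment ending at its lowest corner, or to `none` if that corner
  -- is a corner of `R`.
  have hex : ∀ w, ∃ o : Option {b : T.Black // ¬ T.IsBoundary b},
      (o = none ∧ ∃ k, T.IsCornerSlot k ⟨w, lo w⟩) ∨ ∃ p s s', ∃ H : T.IsTee p s s',
        ((⟨w, lo w⟩ : T.Slot) = s ∨ (⟨w, lo w⟩ : T.Slot) = s') ∧
          o = some ⟨_, H.not_isBoundary⟩ := by
    intro w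
    rcases exists_isCornerSlot_or_exists_isTee hnd hquad ⟨w, lo w⟩ with h | ⟨s, s', H, h⟩
    · exact ⟨none, Or.inl ⟨rfl, h⟩⟩
    · exact ⟨_, Or.inr ⟨_, s, s', H, h, rfl⟩⟩
  -- The segment ending at the lowest corner of a tile goes upward from there.
  have hpos : ∀ {p : ℂ} {s s' : T.Slot}, T.IsTee p s s' → (IsLowest t s ∨ IsLowest t s') →
      0 < tilt t (T.outEdge s') := by
    rintro p s s' H (h | h)
    · obtain ⟨ν, hν, h2⟩ := H.ending
      have := (h.tilt_pos ht).1
      rw [h2, map_smul, smul_eq_mul] at this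
      by_contra hn
      nlinarith
    · exact (h.tilt_pos ht).2
  choose g hg using hex
  rw [← Fintype.card_option]
  refine Fintype.card_le_of_injective g fun w w' hw => ?_
  rcases hg w with ⟨h1, k, hk⟩ | ⟨p, s, s', H, hs, h1⟩ <;>
    rcases hg w' with ⟨h1', k', hk'⟩ | ⟨p', r, r', H', hr, h1'⟩
  -- Two tiles sent to `none` both sit at the strict minimum of the height on `R`, a corner met by
  -- one tile only.
  · have hR : ∀ {w k}, T.IsCornerSlot k ⟨w, lo w⟩ → ∀ l, l ≠ k →
        tilt t (R.vertex k) < tilt t (R.vertex l) := by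
      intro w k hk l hl
      obtain ⟨h2, h3⟩ := (hlo w).tilt_pos ht
      obtain ⟨c, hc, e⟩ := hk.outEdge
      obtain ⟨c', hc', e'⟩ := hk.inEdge
      rw [e, map_smul, smul_eq_mul] at h3
      rw [e', map_smul, smul_eq_mul] at h2
      exact R.lt_vertex_of_turn (tilt t) (by by_contra hn; nlinarith)
        (pos_of_mul_pos_right h3 hc.le) hl
    have hkk : k = k' := by
      by_contra hne
      have a1 := hR hk k' (Ne.symm hne)
      have a2 := hR hk' k hne
      linarith
    subst hkk
    exact (congrArg Sigma.fst (hk.eq_of_pt_eq _ hk'.pt_eq)).symm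
  · rw [h1, h1'] at hw
    exact absurd hw (by simp)
  · rw [h1, h1'] at hw
    exact absurd hw (by simp)
  · rw [h1, h1', Option.some_inj, Subtype.mk.injEq] at hw
    have hlow : ∀ {w} {p : ℂ} {s s' : T.Slot}, T.IsTee p s s' →
        ((⟨w, lo w⟩ : T.Slot) = s ∨ (⟨w, lo w⟩ : T.Slot) = s') →
        (IsLowest t s ∨ IsLowest t s') := by
      rintro w p s s' H (h | h)
      exacts [Or.inl (h ▸ hlo w), Or.inr (h ▸ hlo w)]
    have hP := hpos H (hlow H hs)
    have hP' := hpos H' (hlow H' hr)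
    have hp : p ∈ (T.outBlack s').1 := H.pt_right ▸ T.vertex_mem_black s'.1 s'.2
    have hp' : p' ∈ (T.outBlack r').1 := H'.pt_right ▸ T.vertex_mem_black r'.1 r'.2
    obtain ⟨c, hc, e⟩ := H.ray p' (hw ▸ hp')
    obtain ⟨c', hc', e'⟩ := H'.ray p (hw ▸ hp)
    have a1 := congrArg (tilt t) e
    have a2 := congrArg (tilt t) e'
    rw [map_add, map_smul, smul_eq_mul] at a1 a2
    -- The common segment goes upward from `p` and from `p'`, and each lies on the ray from the
    -- other, so the two points coincide.
    have hc0 : c = 0 := by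
      by_contra hne
      have := mul_pos (lt_of_le_of_ne hc (Ne.symm hne)) hP
      have := mul_nonneg hc' hP'.le
      linarith
    rw [hc0, zero_smul, add_zero] at e
    subst e
    have hpt : T.pt ⟨w', lo w'⟩ = p' := by
      rcases hr with h | h
      · rw [h, H'.pt_left]
      · rw [h, H'.pt_right]
    rcases hs with h | h <;> rcases H.eq_or_eq _ hpt with h' | h'
    · exact congrArg Sigma.fst (h.trans h'.symm)
    · exact absurd (h' ▸ hlo w') (H.not_isLowest ht (h ▸ hlo w))
    · exact absurd (h ▸ hlo w) (H.not_isLowest ht (h' ▸ hlo w'))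
    · exact congrArg Sigma.fst (h.trans h'.symm)

end ConvexTiling

/-! ### The map from intercepts to areas -/

namespace ConvexTiling

variable {R : ConvexPolygon} {W : Type*} {T : ConvexTiling R W} [Fintype W]

variable (T) in
/-- The tile `w` after the maximal segments are moved. -/
noncomputable def moved (x : T.Offset) (w : W) : Fin (T.tile w).n → ℂ :=
  (T.tile w).vertex + T.disp w x

theorem moved_mem_homologyTiles (x : T.Offset) (w : W) :
    T.moved x w ∈ (T.tile w).homologyTiles :=
  ConvexPolygon.add_mem_homologyTiles (T.tile w).vertex_mem_homologyTiles
    (disp_mem_homologyTiles w x)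

theorem moved_zero (w : W) : T.moved 0 w = (T.tile w).vertex := by
  rw [moved, map_zero, add_zero]

theorem moved_add (x v : T.Offset) (w : W) : T.moved (x + v) w = T.moved x w + T.disp w v := by
  rw [moved, moved, map_add, add_assoc]

theorem continuous_moved (w : W) : Continuous fun x : T.Offset => T.moved x w :=
  continuous_const.add (LinearMap.continuous_of_finiteDimensional (T.disp w))

variable (T) in
/-- Half of the derivative of the areas of the tiles. -/
noncomputable def areaDeriv (x : T.Offset) : T.Offset →ₗ[ℝ] (W → ℝ) :=
  LinearMap.pi fun w => (areaForm _ (T.moved x w)).comp (T.disp w)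

theorem areaDeriv_apply (x v : T.Offset) (w : W) :
    T.areaDeriv x v w = areaForm _ (T.moved x w) (T.disp w v) := rfl

theorem pathArea_moved_add_smul (x v : T.Offset) (s : ℝ) (w : W) :
    pathArea (T.moved (x + s • v) w) =
      pathArea (T.moved x w) + 2 * (s * T.areaDeriv x v w) + s ^ 2 * pathArea (T.disp w v) := by
  rw [moved_add, pathArea_add, map_smul, map_smul, pathArea_smul, areaDeriv_apply, smul_eq_mul]

theorem areaForm_vertex_pos {x : T.Offset} {w : W} (h : 0 < pathArea (T.moved x w))
    (h0 : 0 ≤ areaForm _ (T.tile w).vertex (T.moved x w)) :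
    0 < areaForm _ (T.tile w).vertex (T.moved x w) :=
  lt_of_le_of_ne h0 fun h1 => (ConvexPolygon.pathArea_of_areaForm_eq_zero
    (T.tile w).vertex_mem_homologyTiles (moved_mem_homologyTiles x w)
    (T.tile w).pathArea_vertex_pos h1.symm).1.not_gt h

variable (hnd : T.Nondegenerate) (hquad : T.QuadFaces)
include hnd hquad

theorem eq_zero_of_pathArea_disp_nonpos {v : T.Offset}
    (h : ∀ w, pathArea (T.disp w v) ≤ 0 ∧
      (pathArea (T.disp w v) = 0 → ∀ j k, T.disp w v j = T.disp w v k)) : v = 0 := by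
  have h0 := sum_pathArea_disp hnd hquad v
  rw [Finset.sum_eq_zero_iff_of_nonpos fun w _ => (h w).1] at h0
  exact eq_zero_of_disp_const hnd hquad fun w => (h w).2 (h0 w (Finset.mem_univ w))

/-- A kernel vector displaces every tile orthogonally to a path of positive area, so all the
quadratic parts are nonpositive; conservation and rigidity finish. -/
theorem ker_areaDeriv {x : T.Offset} (hx : ∀ w, 0 < pathArea (T.moved x w)) :
    LinearMap.ker (T.areaDeriv x) = ⊥ := by
  rw [LinearMap.ker_eq_bot']
  intro v hv
  refine eq_zero_of_pathArea_disp_nonpos hnd hquad fun w => ?_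
  exact ConvexPolygon.pathArea_of_areaForm_eq_zero (moved_mem_homologyTiles x w)
    (disp_mem_homologyTiles w v) (hx w) (congrFun hv w)

theorem sum_areaDeriv (x v : T.Offset) : ∑ w, T.areaDeriv x v w = 0 :=
  sum_areaForm_disp hnd hquad x v

/-- The only linear relation between the derivatives of the areas is that their sum vanishes. -/
theorem eq_of_sum_mul_areaDeriv {x : T.Offset} (hx : ∀ w, 0 < pathArea (T.moved x w))
    {c : W → ℝ} (hc : ∀ v, ∑ w, c w * T.areaDeriv x v w = 0) (w w' : W) : c w = c w' := by
  classical
  have : Fintype {b : T.Black // ¬ T.IsBoundary b} := Fintype.ofFinite _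
  let σ : (W → ℝ) →ₗ[ℝ] ℝ := ∑ w, LinearMap.proj w
  have hσ : ∀ f : W → ℝ, σ f = ∑ w, f w := fun f => by simp [σ]
  have hle : LinearMap.range (T.areaDeriv x) ≤ LinearMap.ker σ := by
    rintro _ ⟨v, rfl⟩
    rw [LinearMap.mem_ker, hσ, sum_areaDeriv hnd hquad]
  have hsurj : LinearMap.range σ = ⊤ := LinearMap.range_eq_top.2 fun r =>
    ⟨Pi.single w r, by rw [hσ, Finset.sum_pi_single' w r Finset.univ]; simp⟩
  have h1 := LinearMap.finrank_range_add_finrank_ker σ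
  rw [hsurj, finrank_top, Module.finrank_self, Module.finrank_fintype_fun_eq_card] at h1
  have h2 := LinearMap.finrank_range_of_inj (LinearMap.ker_eq_bot.1 (ker_areaDeriv hnd hquad hx))
  rw [Module.finrank_fintype_fun_eq_card] at h2
  have h3 := card_le hnd hquad
  -- The rank is the number of interior segments, by injectivity, and `card_le` bounds it below by
  -- the dimension of the sum-zero hyperplane.
  have heq := Submodule.eq_of_le_of_finrank_le hle (by omega)
  have hmem : (Pi.single w 1 - Pi.single w' 1 : W → ℝ) ∈ LinearMap.ker σ := by
    rw [LinearMap.mem_ker, hσ]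
    simp
  rw [← heq] at hmem
  obtain ⟨v, hv⟩ := hmem
  have := hc v
  rw [hv] at this
  simpa [mul_sub, Finset.sum_sub_distrib, Pi.single_apply, sub_eq_zero] using this

/-- The polar values against the original tiles are affine in `x`, nonnegative, and sum to the area
of `R`. So `areaDeriv 0` is bounded on this set, and it is injective. -/
theorem isBounded_setOf_areaForm_nonneg : Bornology.IsBounded
    {x : T.Offset | ∀ w, 0 ≤ areaForm _ (T.tile w).vertex (T.moved x w)} := by
  have : Fintype {b : T.Black // ¬ T.IsBoundary b} := Fintype.ofFinite _
  have hker := ker_areaDeriv hnd hquad (x := (0 : T.Offset)) fun w => by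
    rw [moved_zero]; exact (T.tile w).pathArea_vertex_pos
  obtain ⟨K, -, hK⟩ := LinearMap.exists_antilipschitzWith _ hker
  refine (hK.isBounded_preimage (Metric.isBounded_closedBall (x := 0) (r := R.area))).subset ?_
  intro x hx
  have htot : ∑ w, pathArea (T.tile w).vertex = R.area := by
    have := sum_pathArea hnd hquad (0 : T.Offset)
    simpa using this
  have hlow : ∀ w, 0 ≤ pathArea (T.tile w).vertex + T.areaDeriv 0 x w := by
    intro w
    have := hx w
    rw [moved, map_add, areaForm_self] at this
    rwa [areaDeriv_apply, moved_zero]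
  have hsum := sum_areaDeriv hnd hquad 0 x
  have hR : 0 < R.area := R.pathArea_vertex_pos
  rw [Set.mem_preimage, mem_closedBall_zero_iff, pi_norm_le_iff_of_nonneg hR.le]
  intro w
  have hpos : ∀ w, 0 < pathArea (T.tile w).vertex := fun w => (T.tile w).pathArea_vertex_pos
  have h1 : pathArea (T.tile w).vertex ≤ R.area := by
    rw [← htot]
    exact Finset.single_le_sum (f := fun w => pathArea (T.tile w).vertex)
      (fun w _ => (hpos w).le) (Finset.mem_univ w)
  have h2 : pathArea (T.tile w).vertex + T.areaDeriv 0 x w ≤ R.area := by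
    have : ∑ w, (pathArea (T.tile w).vertex + T.areaDeriv 0 x w) = R.area := by
      rw [Finset.sum_add_distrib, htot, hsum, add_zero]
    rw [← this]
    exact Finset.single_le_sum (f := fun w => pathArea (T.tile w).vertex + T.areaDeriv 0 x w)
      (fun w _ => hlow w) (Finset.mem_univ w)
  rw [Real.norm_eq_abs, abs_le]
  constructor
  · linarith [hlow w]
  · linarith [hpos w]

/-- Equal areas make the difference of the two paths orthogonal to their sum, and equal orientation
makes the area of the sum positive. -/
theorem offset_unique {x y : T.Offset} (hx : ∀ w, 0 < pathArea (T.moved x w))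
    (hxy : ∀ w, pathArea (T.moved x w) = pathArea (T.moved y w))
    (hx' : ∀ w, 0 < areaForm _ (T.tile w).vertex (T.moved x w))
    (hy' : ∀ w, 0 < areaForm _ (T.tile w).vertex (T.moved y w)) : x = y := by
  rw [← sub_eq_zero]
  refine eq_zero_of_pathArea_disp_nonpos hnd hquad fun w => ?_
  have hpos := ConvexPolygon.areaForm_pos (T.tile w).vertex_mem_homologyTiles
    (moved_mem_homologyTiles x w) (moved_mem_homologyTiles y w) (T.tile w).pathArea_vertex_pos
    (hx w) (hxy w ▸ hx w) (hx' w) (hy' w)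
  have hd : T.disp w (x - y) = T.moved x w - T.moved y w := by
    rw [moved, moved, map_sub, add_sub_add_left_eq_sub]
  refine ConvexPolygon.pathArea_of_areaForm_eq_zero (u := T.moved x w + T.moved y w)
    (ConvexPolygon.add_mem_homologyTiles (moved_mem_homologyTiles x w)
      (moved_mem_homologyTiles y w)) (disp_mem_homologyTiles w _) ?_ ?_
  · rw [pathArea_add]
    have := hx w
    have := hxy w
    linarith
  · rw [hd, map_sub, map_add, LinearMap.add_apply, LinearMap.add_apply, areaForm_self,
      areaForm_self, areaForm_comm (T.moved y w), hxy w]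
    ring

/-- Criticality says that the ratios `A w / area` annihilate the image of `areaDeriv x`, so they are
all equal; the two totals agree, so the common ratio is one. -/
theorem pathArea_eq_of_isLocalMax {A : W → ℝ} (hsum : ∑ w, A w = R.area) {x : T.Offset}
    (hx : ∀ w, 0 < pathArea (T.moved x w))
    (hmax : ∀ v, IsLocalMax (fun s : ℝ => ∑ w, A w * Real.log (pathArea (T.moved (x + s • v) w))) 0)
    (w : W) : pathArea (T.moved x w) = A w := by
  have hcrit : ∀ v, ∑ w, A w / pathArea (T.moved x w) * T.areaDeriv x v w = 0 := by
    intro v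
    have hder : HasDerivAt (fun s : ℝ => ∑ w, A w * Real.log (pathArea (T.moved (x + s • v) w)))
        (∑ w, A w * (2 * T.areaDeriv x v w / pathArea (T.moved x w))) 0 := by
      refine HasDerivAt.fun_sum fun w _ => HasDerivAt.const_mul _ ?_
      have h1 : HasDerivAt (fun s : ℝ => pathArea (T.moved (x + s • v) w))
          (2 * T.areaDeriv x v w) 0 := by
        simp only [pathArea_moved_add_smul]
        have := (((hasDerivAt_id (0 : ℝ)).mul_const (T.areaDeriv x v w)).const_mul 2).const_add
          (pathArea (T.moved x w))
        have h2 := (((hasDerivAt_id (0 : ℝ)).pow 2).mul_const (pathArea (T.disp w v)))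
        simpa using this.fun_add h2
      have h0 : pathArea (T.moved (x + (0 : ℝ) • v) w) = pathArea (T.moved x w) := by simp
      have := h1.log (by rw [h0]; exact (hx w).ne')
      rwa [h0] at this
    have h0 := (hmax v).hasDerivAt_eq_zero hder
    have h2 : ∑ w, A w * (2 * T.areaDeriv x v w / pathArea (T.moved x w))
        = 2 * ∑ w, A w / pathArea (T.moved x w) * T.areaDeriv x v w := by
      rw [Finset.mul_sum]
      exact Finset.sum_congr rfl fun w _ => by ring
    rw [h2] at h0
    linarith
  have hc := eq_of_sum_mul_areaDeriv hnd hquad hx hcrit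
  have hA : ∀ w', A w' = A w / pathArea (T.moved x w) * pathArea (T.moved x w') := fun w' => by
    rw [hc w w', div_mul_cancel₀ _ (hx w').ne']
  have htot : ∑ w, pathArea (T.moved x w) = R.area := sum_pathArea hnd hquad x
  have hR : 0 < R.area := R.pathArea_vertex_pos
  have h1 : R.area = A w / pathArea (T.moved x w) * R.area := by
    nth_rw 1 [← hsum]
    rw [← htot, Finset.mul_sum]
    exact Finset.sum_congr rfl fun w' _ => hA w'
  have h2 : A w / pathArea (T.moved x w) = 1 := by
    have := mul_right_cancel₀ hR.ne' (h1.symm.trans (one_mul _).symm)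
    exact this
  exact ((div_eq_one_iff_eq (hx w).ne').1 h2).symm

theorem exists_offset {A : W → ℝ} (hA : ∀ w, 0 < A w) (hsum : ∑ w, A w = R.area) :
    ∃ x : T.Offset, ∀ w, pathArea (T.moved x w) = A w ∧
      0 < areaForm _ (T.tile w).vertex (T.moved x w) := by
  have : Fintype {b : T.Black // ¬ T.IsBoundary b} := Fintype.ofFinite _
  have hcQ : ∀ w, Continuous fun x : T.Offset => pathArea (T.moved x w) := fun w =>
    continuous_pathArea.comp (continuous_moved w)
  have hcB : ∀ w, Continuous fun x : T.Offset =>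
      areaForm _ (T.tile w).vertex (T.moved x w) := fun w =>
    (ConvexPolygon.continuous_areaForm_right _).comp (continuous_moved w)
  let K : Set T.Offset := {x | (∀ w, 0 ≤ pathArea (T.moved x w)) ∧
    ∀ w, 0 ≤ areaForm _ (T.tile w).vertex (T.moved x w)}
  have hK : IsCompact K := by
    refine Metric.isCompact_of_isClosed_isBounded ?_
      ((isBounded_setOf_areaForm_nonneg hnd hquad).subset fun x hx => hx.2)
    simp only [K, Set.ofPred_and, Set.ofPred_forall]
    exact (isClosed_iInter fun w => isClosed_le continuous_const (hcQ w)).inter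
      (isClosed_iInter fun w => isClosed_le continuous_const (hcB w))
  have h0 : (0 : T.Offset) ∈ K := by
    constructor <;> intro w <;> rw [moved_zero]
    · exact (T.tile w).pathArea_vertex_pos.le
    · rw [areaForm_self]; exact (T.tile w).pathArea_vertex_pos.le
  -- The product, unlike the sum of logarithms, is continuous on all of `K`; it vanishes where an
  -- area does and is positive at the original tiling.
  let Φ : T.Offset → ℝ := fun x => ∏ w, pathArea (T.moved x w) ^ A w
  have hΦ : Continuous Φ := continuous_finsetProd _ fun w _ =>
    (hcQ w).rpow_const fun x => Or.inr (hA w).le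
  obtain ⟨x, hx, hmax⟩ := hK.exists_isMaxOn ⟨0, h0⟩ hΦ.continuousOn
  have hΦ0 : 0 < Φ 0 := Finset.prod_pos fun w _ => by
    rw [moved_zero]; exact Real.rpow_pos_of_pos (T.tile w).pathArea_vertex_pos _
  have hΦx : 0 < Φ x := hΦ0.trans_le (hmax h0)
  have hQ : ∀ w, 0 < pathArea (T.moved x w) := by
    intro w
    refine lt_of_le_of_ne (hx.1 w) fun h => hΦx.ne' ?_
    exact Finset.prod_eq_zero (Finset.mem_univ w) (by rw [← h, Real.zero_rpow (hA w).ne'])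
  have hB : ∀ w, 0 < areaForm _ (T.tile w).vertex (T.moved x w) := fun w =>
    areaForm_vertex_pos (hQ w) (hx.2 w)
  refine ⟨x, fun w => ⟨pathArea_eq_of_isLocalMax hnd hquad hsum hQ (fun v => ?_) w, hB w⟩⟩
  have hlog : ∀ y : T.Offset, (∀ w, 0 < pathArea (T.moved y w)) →
      ∑ w, A w * Real.log (pathArea (T.moved y w)) = Real.log (Φ y) := by
    intro y hy
    rw [Real.log_prod fun w _ => (Real.rpow_pos_of_pos (hy w) _).ne']
    exact Finset.sum_congr rfl fun w _ => (Real.log_rpow (hy w) _).symm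
  have hline : Continuous fun s : ℝ => x + s • v := by fun_prop
  -- All the inequalities are strict at the maximizer, so nearby points of each line through it stay
  -- in `K`.
  have hev : ∀ᶠ s in nhds (0 : ℝ), (∀ w, 0 < pathArea (T.moved (x + s • v) w)) ∧
      ∀ w, 0 < areaForm _ (T.tile w).vertex (T.moved (x + s • v) w) := by
    refine (Filter.eventually_all.2 fun w => ?_).and (Filter.eventually_all.2 fun w => ?_)
    · exact (((hcQ w).comp hline).tendsto 0).eventually_const_lt (by simpa using hQ w)
    · exact (((hcB w).comp hline).tendsto 0).eventually_const_lt (by simpa using hB w)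
  filter_upwards [hev] with s hs
  have hs0 : x + (0 : ℝ) • v = x := by simp
  rw [hs0, hlog _ hs.1, hlog _ hQ]
  exact Real.log_le_log (Finset.prod_pos fun w _ => Real.rpow_pos_of_pos (hs.1 w) _)
    (hmax ⟨fun w => (hs.1 w).le, fun w => (hs.2 w).le⟩)

end ConvexTiling

theorem mainTheorem3 {W : Type*} [Fintype W] (R : ConvexPolygon) (T : ConvexTiling R W)
    (hnd : T.Nondegenerate) (hquad : T.QuadFaces)
    (A : W → ℝ) (hA : ∀ w, 0 < A w) (hsum : ∑ w, A w = R.area) :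
    ∃! H : T.HomologyTiling, ∀ w,
      pathArea (H.path w) = A w ∧ (T.tile w).SameOrientation (H.path w) := by
  have hiff : ∀ (x : T.Offset) (w : W), pathArea (T.moved x w) = A w →
      ((T.tile w).SameOrientation (T.moved x w) ↔
        0 < areaForm _ (T.tile w).vertex (T.moved x w)) := fun x w h => by
    rw [ConvexPolygon.sameOrientation_iff (h ▸ hA w)]
    exact and_iff_right (ConvexTiling.moved_mem_homologyTiles x w)
  obtain ⟨x, hx⟩ := ConvexTiling.exists_offset hnd hquad hA hsum
  refine ⟨T.homologyTilingOf x, fun w => ⟨(hx w).1, (hiff x w (hx w).1).2 (hx w).2⟩, ?_⟩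
  intro H hH
  obtain ⟨y, rfl⟩ := ConvexTiling.exists_eq_homologyTilingOf H
  have hy : ∀ w, pathArea (T.moved y w) = A w ∧ (T.tile w).SameOrientation (T.moved y w) := hH
  rw [ConvexTiling.offset_unique hnd hquad (x := x) (y := y) (fun w => (hx w).1 ▸ hA w)
    (fun w => (hx w).1.trans (hy w).1.symm) (fun w => (hx w).2)
    fun w => (hiff y w (hy w).1).1 (hy w).2]
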